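/- **Conventions.** Signatures are many-sorted and structures have non-empty carriers. Let $\mathcal T_0$ be a set of first-order sentences over a signature $\Pi_0=(S,\Sigma_0,\mathsf{Pred})$ and $\mathcal K$ a set of universally closed clauses over $\Pi=(S,\Sigma_0\cup\Sigma,\mathsf{Pred})$, where $\Sigma$ is a set of additional (extension) function symbols. Extension constants are the $0$-ary symbols of $\Sigma$; extension terms are the terms with root symbol in $\Sigma$. $\mathsf{UIF}_{\Sigma'}$ says that the symbols in $\Sigma'$ are uninterpreted, i.e. it adds no axioms. A finite set of ground clauses is identified with its conjunction. $\mathcal K[T]$ is the set of instances of clauses of $\mathcal K$ whose extension terms all lie in $T$; $\mathsf{est}(\mathcal K,G)$ is the set of ground extension terms occurring in $\mathcal K$ or $G$. The extension $\mathcal T_0\subseteq\mathcal T_0\cup\mathcal K$ is *local* if for every finite set $G$ of ground clauses with additional constants, $\mathcal T_0\cup\mathcal K\cup G\models\bot$ iff $\mathcal T_0\cup\mathcal K[\mathsf{est}(\mathcal K,G)]\cup G\models\bot$. $\Theta_{\mathcal K}(\Sigma_s)$ is the set of all $f\in\Sigma$ equivalent to some $g\in\Sigma_s$ under the equivalence relation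 generated by "$f$ and $g$ occur in a common clause of $\mathcal K$". A non-ground (resp. ground) clause is *flat* if all arguments of extension symbols are variables (resp. constants); it is *linear* if a variable (resp. constant) occurring in two extension terms of positive arity occurs in identical ones, and no extension term contains it twice. $\mathcal T_0$ is *convex* if whenever a conjunction of ground atoms (with additional constants) entails modulo $\mathcal T_0$ a non-empty disjunction of equations, it entails one of them. It is *stably infinite* if every ground formula satisfiable in a model of $\mathcal T_0$ is satisfiable in an infinite one. It is *equality interpolating* if, whenever $A,B$ are conjunctions of ground literals with $A\wedge B$ satisfiable modulo $\mathcal T_0$ and $A\wedge B\models_{\mathcal T_0}a\approx b$ for constants $a$ of $A$ and $b$ of $B$, there is a term $t$ containing only additional constants common to $A$ and $B$ with $A\wedge B\models_{\mathcal T_0}a\approx t\wedge t\approx b$. It *allows quantifier elimination* if every formula is equivalent modulo $\mathcal T_0$ to a quantifier-free formula in the same free variables. Let $C$ be a family of additional constants. A ground formula $\psi$ is a *$\mathcal T$-general uniform interpolant* of $\phi$ w.r.t. $\Sigma_s\cup C_s$ if its extension symbols are in $\Sigma_s$, its additional constants are in $C_s$, $\phi\models_{\mathcal T}\psi$, and $\psi\models_{\mathcal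 T}\theta$ for every ground $\Pi^C$-formula $\theta$ which has in common with $\phi$ only extension symbols in $\Sigma_s$ and additional constants in $C_s$ and satisfies $\phi\models_{\mathcal T}\theta$. A ground formula $\psi$ is a *$\mathcal T$-uniform interpolant* of $\phi$ w.r.t. $C_s$ if its additional constants are in $C_s$, $\phi\models_{\mathcal T}\psi$, and $\psi\models_{\mathcal T}\theta$ for every ground $\theta$ (over arbitrary symbols of the signature and arbitrary further fresh constants) whose common additional constants with $\phi$ are in $C_s$ and for which $\phi\models_{\mathcal T}\theta$. **Algorithm 1** (input: $\mathcal T_0\subseteq\mathcal T_0\cup\mathcal K$, ground clauses $G$, a set $T$ of ground terms, symbols $\Sigma_s$ and constants $C_s$ to be kept). (1) In $\mathcal K[T]\cup G$ replace the extension terms $t$ by new constants $c_t$, giving $\mathcal K_0\cup G_0$, and add the congruence axioms $\mathsf{Con}_0=\{\bigwedge_i c_i\approx d_i\to c_t\approx c_{t'}\}$ for all extension terms $t=f(c_1,\dots,c_n)$, $t'=f(d_1,\dots,d_n)$ occurring there. (2) Keep the constants in $C_s$, the constants $c_t$ for occurring terms $t$ with root symbol in $\Sigma_s$, and the arguments of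 such $t$. (3) Let $\Gamma_1$ be any quantifier-free $\Pi_0$-formula in the kept constants that is equivalent modulo $\mathcal T_0$ to $\exists\overline x\,(\mathcal K_0\wedge G_0\wedge\mathsf{Con}_0)$, where $\overline x$ replaces all other constants. (4) The result $\Gamma$ is $\Gamma_1$ with each $c_t$ replaced by $t$. **Theorem.** Let $\mathcal T_0$ be a convex, stably infinite, equality interpolating many-sorted theory with signature $\Pi_0=(S,\Sigma_0,\mathsf{Pred})$ allowing quantifier elimination. Let $G$ be a finite set of flat and linear ground $\Pi^C$-clauses, $\Sigma_s\subseteq\Sigma$ and $C_s\subseteq C$ sets of extension symbols and additional constants occurring in $G$, and $\Sigma_s'=\Theta_{\mathcal K}(\Sigma_s)$, $\Sigma_1=\Sigma\setminus\Sigma_s'$. Let $\mathcal T_0\subseteq\mathcal T:=\mathcal T_0\cup\mathcal K$ be a local extension such that: * **(A1)** $\Sigma$ is finite, and $S=S_1\cup S_2$ with $S_1\cap S_2=\emptyset$; * **(A2)** $\mathcal K=\mathcal K_s\cup\mathcal K_1$ is a finite set of flat and linear clauses in each of which every variable occurs below an extension symbol; $\mathcal K_s$ consists of $\Pi_0\cup\Sigma_s'$-clauses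 and $\mathcal K_1$ of $\Pi_0\cup\Sigma_1$-clauses; (a) every $f\in\Sigma_0\cup\Sigma$ of arity $\ge1$ has its output sort in $S_2$; (b) all argument sorts of the symbols in $\Sigma_s'$ are in $S_1$; (c) all constants of a sort in $S_1$ are in $\Sigma_s'\cup C$. Assume moreover that every constant of $C$ of a sort in $S_1$ occurs in $G$, and that every symbol in $\Theta_{\mathcal K}(\Sigma_e)$ occurs in $G$, where $\Sigma_e$ is the set of extension symbols of $G$ not in $\Sigma_s'$. Let $T$ be the set of all terms $f(c_1,\dots,c_n)$ with $f\in\Sigma_s'$ and constants $c_i\in\Sigma_s'\cup C$ of the appropriate sorts. Then $T$ and $\mathcal K_s[T]$ are finite, and every $\mathcal T_0\cup\mathsf{UIF}_{\Sigma_s'}\cup\mathcal K_1$-general uniform interpolant of $G\wedge\mathcal K_s[T]$ w.r.t. $\Sigma_s'\cup C_s$ is a $\mathcal T$-general uniform interpolant of $G$ w.r.t. $\Sigma_s'\cup C_s$. Moreover such an interpolant is obtained as follows. 1. Algorithm 1, applied to $\mathcal T_0\cup\mathsf{UIF}_{\Sigma_s'}\cup\mathcal K_1$, $G\wedge\mathcal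 K_s[T]$, the set of terms $\mathsf{est}(\mathcal K_1,G\wedge\mathcal K_s[T])$, and the symbols $\Sigma_s'$ and constants $C_s$ to be kept, has a result; and every result $\Gamma$ contains only extension symbols in $\Sigma_s'$ and additional constants in $\overline{C_s}$, where $\overline{C_s}$ consists of $C_s$ and of all constants of $C$ which are arguments of symbols of $\Sigma_s'$ in $G\wedge\mathcal K_s[T]$. 2. For every such $\Gamma$, there is a $\mathcal T_0\cup\mathsf{UIF}_{\Sigma_s'\cup\Sigma_1}$-uniform interpolant $\psi$ of $\Gamma$ w.r.t. $C_s$ whose extension symbols are in $\Sigma_s'$; and every such $\psi$ is a $\mathcal T_0\cup\mathsf{UIF}_{\Sigma_s'}\cup\mathcal K_1$-general uniform interpolant of $G\wedge\mathcal K_s[T]$ w.r.t. $\Sigma_s'\cup C_s$, and hence a $\mathcal T$-general uniform interpolant of $G$ w.r.t. $\Sigma_s'\cup C_s$. -/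

import Mathlib

universe u

namespace ManySorted

variable {S : Type u}

/-! ### Many-sorted signatures, terms, formulas -/

/-- Function symbols over a set `S` of sorts; `f` has arity `dom f 0, …, dom f (n-1) → cod f`.
Symbols with `arity f = 0` are constants. -/
structure FunSig (S : Type u) where
  Sym : Type u
  arity : Sym → ℕ
  dom : (f : Sym) → Fin (arity f) → S
  cod : Sym → S

/-- Predicate symbols over a set `S` of sorts. -/
structure RelSig (S : Type u) where
  Sym : Type u
  arity : Sym → ℕ
  dom : (p : Sym) → Fin (arity p) → S

/-- The disjoint union of two families of function symbols: base symbols `Sum.inl f` and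
extension symbols `Sum.inr f`. -/
def FunSig.sum (F E : FunSig S) : FunSig S where
  Sym := F.Sym ⊕ E.Sym
  arity := fun f => match f with
    | .inl f => F.arity f
    | .inr f => E.arity f
  dom := fun f => match f with
    | .inl f => F.dom f
    | .inr f => E.dom f
  cod := fun f => match f with
    | .inl f => F.cod f
    | .inr f => E.cod f

/-- Terms with variables in the family `V`. The family `V` plays two roles: variables of
axioms, or additional fresh constants `C`; a ground term over the signature expanded by `C` is a
term with "variables" `C`, and interpreting the constants is choosing a valuation. -/
inductive Term (F : FunSig S) (V : S → Type u) : S → Type u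
  | var {s : S} (x : V s) : Term F V s
  | app (f : F.Sym) (args : ∀ i, Term F V (F.dom f i)) : Term F V (F.cod f)

inductive Atom (F : FunSig S) (P : RelSig S) (V : S → Type u) : Type u
  | eq {s : S} (t t' : Term F V s) : Atom F P V
  | rel (p : P.Sym) (args : ∀ i, Term F V (P.dom p i)) : Atom F P V

inductive Literal (F : FunSig S) (P : RelSig S) (V : S → Type u) : Type u
  | pos (a : Atom F P V) : Literal F P V
  | neg (a : Atom F P V) : Literal F P V

/-- A clause is a finite disjunction of literals. -/
abbrev Clause (F : FunSig S) (P : RelSig S) (V : S → Type u) : Type u := List (Literal F P V)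

/-- Quantifier-free formulas (ground formulas, if `V` is a family of constants). -/
inductive QF (F : FunSig S) (P : RelSig S) (V : S → Type u) : Type u
  | falsum : QF F P V
  | atom (a : Atom F P V) : QF F P V
  | neg (φ : QF F P V) : QF F P V
  | conj (φ ψ : QF F P V) : QF F P V
  | disj (φ ψ : QF F P V) : QF F P V

/-- The family `V` with one more variable, of sort `s`. -/
def AddVar (V : S → Type u) (s : S) : S → Type u := fun t => V t ⊕ ULift.{u} (PLift (t = s))

/-- First-order formulas with free variables in `V`. -/
inductive Formula (F : FunSig S) (P : RelSig S) : (S → Type u) → Type (u + 1)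
  | qf {V : S → Type u} (φ : QF F P V) : Formula F P V
  | neg {V : S → Type u} (φ : Formula F P V) : Formula F P V
  | conj {V : S → Type u} (φ ψ : Formula F P V) : Formula F P V
  | all {V : S → Type u} (s : S) (φ : Formula F P (AddVar V s)) : Formula F P V

/-- Closed formulas. -/
abbrev Sentence (F : FunSig S) (P : RelSig S) : Type (u + 1) := Formula F P fun _ => PEmpty.{u + 1}

def Literal.toQF {F : FunSig S} {P : RelSig S} {V : S → Type u} : Literal F P V → QF F P V
  | .pos a => .atom a
  | .neg a => .neg (.atom a)

def Clause.toQF {F : FunSig S} {P : RelSig S} {V : S → Type u} (D : Clause F P V) : QF F P V :=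
  D.foldr (fun l φ => .disj l.toQF φ) .falsum

/-! ### Substitution -/

section Subst

variable {F : FunSig S} {P : RelSig S} {V W : S → Type u}

def Term.subst (σ : ∀ s, V s → Term F W s) : ∀ {s : S}, Term F V s → Term F W s
  | _, .var x => σ _ x
  | _, .app f args => .app f fun i => (args i).subst σ

def Atom.subst (σ : ∀ s, V s → Term F W s) : Atom F P V → Atom F P W
  | .eq t t' => .eq (t.subst σ) (t'.subst σ)
  | .rel p args => .rel p fun i => (args i).subst σ

def Literal.subst (σ : ∀ s, V s → Term F W s) : Literal F P V → Literal F P W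
  | .pos a => .pos (a.subst σ)
  | .neg a => .neg (a.subst σ)

def Clause.subst (σ : ∀ s, V s → Term F W s) (D : Clause F P V) : Clause F P W :=
  List.map (Literal.subst σ) D

def QF.subst (σ : ∀ s, V s → Term F W s) : QF F P V → QF F P W
  | .falsum => .falsum
  | .atom a => .atom (a.subst σ)
  | .neg φ => .neg (φ.subst σ)
  | .conj φ ψ => .conj (φ.subst σ) (ψ.subst σ)
  | .disj φ ψ => .disj (φ.subst σ) (ψ.subst σ)

end Subst

/-! ### Semantics -/

/-- Many-sorted structures, with non-empty carriers. -/
structure Struct (F : FunSig S) (P : RelSig S) where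
  carrier : S → Type u
  nonempty : ∀ s, Nonempty (carrier s)
  fn : ∀ f : F.Sym, (∀ i, carrier (F.dom f i)) → carrier (F.cod f)
  rel : ∀ p : P.Sym, (∀ i, carrier (P.dom p i)) → Prop

section Semantics

variable {F : FunSig S} {P : RelSig S} {V : S → Type u}

/-- Valuations of the variables (constants) `V`. -/
abbrev Struct.Val (M : Struct F P) (V : S → Type u) : Type u := ∀ s, V s → M.carrier s

def Term.eval (M : Struct F P) (v : M.Val V) : ∀ {s : S}, Term F V s → M.carrier s
  | _, .var x => v _ x
  | _, .app f args => M.fn f fun i => (args i).eval M v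

def Atom.Realize (M : Struct F P) (v : M.Val V) : Atom F P V → Prop
  | .eq t t' => t.eval M v = t'.eval M v
  | .rel p args => M.rel p fun i => (args i).eval M v

def Literal.Realize (M : Struct F P) (v : M.Val V) : Literal F P V → Prop
  | .pos a => a.Realize M v
  | .neg a => ¬ a.Realize M v

def Clause.Realize (M : Struct F P) (v : M.Val V) (D : Clause F P V) : Prop :=
  ∃ l ∈ D, Literal.Realize M v l

def QF.Realize (M : Struct F P) (v : M.Val V) : QF F P V → Prop
  | .falsum => False
  | .atom a => a.Realize M v
  | .neg φ => ¬ φ.Realize M v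
  | .conj φ ψ => φ.Realize M v ∧ ψ.Realize M v
  | .disj φ ψ => φ.Realize M v ∨ ψ.Realize M v

def Struct.Val.add {M : Struct F P} (v : M.Val V) {s : S} (a : M.carrier s) :
    M.Val (AddVar V s) := fun t x => match x with
  | .inl x => v t x
  | .inr h => h.down.down ▸ a

def Formula.Realize (M : Struct F P) : ∀ {V : S → Type u}, Formula F P V → M.Val V → Prop
  | _, .qf φ, v => φ.Realize M v
  | _, .neg φ, v => ¬ φ.Realize M v
  | _, .conj φ ψ, v => φ.Realize M v ∧ ψ.Realize M v
  | _, .all s φ, v => ∀ a : M.carrier s, φ.Realize M (v.add a)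

/-- `M` is a model of the theory (set of sentences) `T`. -/
def Struct.IsModel (M : Struct F P) (T : Set (Sentence F P)) : Prop :=
  ∀ φ ∈ T, φ.Realize M fun _ x => x.elim

/-- `Φ ⊨_Th θ`, where a theory is given by the class `Th` of its models. -/
def Entails (Th : Set (Struct F P)) (Φ : Set (QF F P V)) (θ : QF F P V) : Prop :=
  ∀ M ∈ Th, ∀ v : M.Val V, (∀ φ ∈ Φ, φ.Realize M v) → θ.Realize M v

/-- The class of models of a set of sentences. -/
def models (T : Set (Sentence F P)) : Set (Struct F P) := {M | M.IsModel T}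

/-- A set of clauses, as a set of formulas. -/
def clauseSet (G : Set (Clause F P V)) : Set (QF F P V) := Clause.toQF '' G

end Semantics

/-! ### Properties of the base theory -/

section Subterms

variable {F : FunSig S} {P : RelSig S} {V : S → Type u}

def Term.subterms : ∀ {s : S}, Term F V s → Set (Σ s, Term F V s)
  | _, .var x => {⟨_, .var x⟩}
  | _, .app f args => insert ⟨_, .app f args⟩ (⋃ i, (args i).subterms)

def Atom.subterms : Atom F P V → Set (Σ s, Term F V s)
  | .eq t t' => t.subterms ∪ t'.subterms
  | .rel _ args => ⋃ i, (args i).subterms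

def QF.subterms : QF F P V → Set (Σ s, Term F V s)
  | .falsum => ∅
  | .atom a => a.subterms
  | .neg φ => φ.subterms
  | .conj φ ψ => φ.subterms ∪ ψ.subterms
  | .disj φ ψ => φ.subterms ∪ ψ.subterms

/-- All subterms of the formulas in a set. -/
def subterms (Φ : Set (QF F P V)) : Set (Σ s, Term F V s) := ⋃ φ ∈ Φ, φ.subterms

/-- The variables (resp. additional constants) among a set of terms closed under subterms. -/
def varsIn (T : Set (Σ s, Term F V s)) : Set (Σ s, V s) := {c | ⟨c.1, .var c.2⟩ ∈ T}

/-- The variables (resp. additional constants) occurring in the formulas of a set. -/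
def consts (Φ : Set (QF F P V)) : Set (Σ s, V s) := varsIn (subterms Φ)

end Subterms

section BaseTheory

variable {F : FunSig S} {P : RelSig S}

/-- Every first-order formula is equivalent modulo `T` to a quantifier-free formula in the same
free variables. -/
def HasQE (T : Set (Sentence F P)) : Prop :=
  ∀ (V : S → Type u) (φ : Formula F P V), ∃ ψ : QF F P V,
    ∀ M ∈ models T, ∀ v : M.Val V, φ.Realize M v ↔ ψ.Realize M v

/-- Every ground formula with additional constants that is satisfiable in a model of `T` is
satisfiable in an infinite model of `T` (its universe is the union of the carriers). -/
def IsStablyInfinite (T : Set (Sentence F P)) : Prop :=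
  ∀ (C : S → Type u) (φ : QF F P C),
    (∃ M ∈ models T, ∃ v : M.Val C, φ.Realize M v) →
    ∃ M ∈ models T, Infinite (Σ s, M.carrier s) ∧ ∃ v : M.Val C, φ.Realize M v

/-- If a conjunction `A` of ground atoms entails a non-empty disjunction of equations, then it
entails one of them. -/
def IsConvex (T : Set (Sentence F P)) : Prop :=
  ∀ (C : S → Type u) (A : List (Atom F P C)) (eqs : List (Σ s, Term F C s × Term F C s)),
    eqs ≠ [] →
    (∀ M ∈ models T, ∀ v : M.Val C, (∀ a ∈ A, a.Realize M v) →
      ∃ e ∈ eqs, e.2.1.eval M v = e.2.2.eval M v) →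
    ∃ e ∈ eqs, ∀ M ∈ models T, ∀ v : M.Val C, (∀ a ∈ A, a.Realize M v) →
      e.2.1.eval M v = e.2.2.eval M v

/-- If a conjunction of literals `A ∧ B` that is satisfiable modulo `T` entails `a ≈ b`, where the
constant `a` occurs in `A` and the constant `b` occurs in `B`, then it entails `a ≈ t` and `t ≈ b`
for a term `t` containing only constants that are common to `A` and `B`. -/
def IsEqInterpolating (T : Set (Sentence F P)) : Prop :=
  ∀ (C : S → Type u) (A B : List (Literal F P C)) (s : S) (a b : C s),
    (⟨s, a⟩ : Σ s, C s) ∈ consts {φ | ∃ l ∈ A, φ = l.toQF} →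
    (⟨s, b⟩ : Σ s, C s) ∈ consts {φ | ∃ l ∈ B, φ = l.toQF} →
    (∃ M ∈ models T, ∃ v : M.Val C, (∀ l ∈ A, l.Realize M v) ∧ ∀ l ∈ B, l.Realize M v) →
    (∀ M ∈ models T, ∀ v : M.Val C, (∀ l ∈ A, l.Realize M v) → (∀ l ∈ B, l.Realize M v) →
      v s a = v s b) →
    ∃ t : Term F C s,
      varsIn t.subterms ⊆
        consts {φ | ∃ l ∈ A, φ = l.toQF} ∩ consts {φ | ∃ l ∈ B, φ = l.toQF} ∧
      ∀ M ∈ models T, ∀ v : M.Val C, (∀ l ∈ A, l.Realize M v) → (∀ l ∈ B, l.Realize M v) →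
        v s a = t.eval M v ∧ t.eval M v = v s b

end BaseTheory

/-! ### Theory extensions -/

section Extensions

variable {F E : FunSig S} {P : RelSig S} {V X C : S → Type u}

/-- The reduct to the base signature. -/
def Struct.reduct (M : Struct (F.sum E) P) : Struct F P where
  carrier := M.carrier
  nonempty := M.nonempty
  fn := fun f => M.fn (Sum.inl f)
  rel := M.rel

/-- The models of `T₀ ∪ K`, where `K` is a set of universally closed clauses over the signature
extended by `E`. Extension symbols which do not occur in `K` are uninterpreted. -/
def extModels (T₀ : Set (Sentence F P)) (K : Set (Clause (F.sum E) P X)) :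
    Set (Struct (F.sum E) P) :=
  {M | M.reduct.IsModel T₀ ∧ ∀ D ∈ K, ∀ v : M.Val X, Clause.Realize M v D}

/-- The models of `T₀ ∪ UIF_E`, where all the symbols of `E` are uninterpreted. -/
def uifModels (T₀ : Set (Sentence F P)) (E : FunSig S) : Set (Struct (F.sum E) P) :=
  {M | M.reduct.IsModel T₀}

/-- The extension symbols occurring in the formulas of a set. -/
def extSyms (Φ : Set (QF (F.sum E) P V)) : Set E.Sym :=
  {f | ∃ args, (⟨_, .app (Sum.inr f) args⟩ : Σ s, Term (F.sum E) V s) ∈ subterms Φ}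

/-- Extension terms: the root symbol is an extension symbol. -/
def Term.IsExt : ∀ {s : S}, Term (F.sum E) V s → Prop
  | _, .var _ => False
  | _, .app (Sum.inl _) _ => False
  | _, .app (Sum.inr _) _ => True

/-- The extension terms occurring in the formulas of a set. -/
def extTerms (Φ : Set (QF (F.sum E) P V)) : Set (Σ s, Term (F.sum E) V s) :=
  {t ∈ subterms Φ | t.2.IsExt}

/-- `K[T]`: the ground instances of clauses of `K` all of whose extension terms are in `T`.
(This is used for clauses in which every variable occurs below an extension symbol, so that
all instances of this kind are ground.) -/
def instances (K : Set (Clause (F.sum E) P X)) (T : Set (Σ s, Term (F.sum E) C s)) :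
    Set (Clause (F.sum E) P C) :=
  {D' | ∃ D ∈ K, ∃ σ : ∀ s, X s → Term (F.sum E) C s,
    D' = Clause.subst σ D ∧ extTerms {Clause.toQF D'} ⊆ T}

/-- `est(K, G)`: the ground extension terms occurring in `K` or in `G`. -/
def est (K : Set (Clause (F.sum E) P X)) (G : Set (Clause (F.sum E) P C)) :
    Set (Σ s, Term (F.sum E) C s) :=
  extTerms (clauseSet G) ∪
    {p | ∃ (s : S) (t : Term (F.sum E) (fun _ => PEmpty.{u + 1}) s),
      (⟨s, t.subst fun _ x => x.elim⟩ : Σ s, Term (F.sum E) X s) ∈ extTerms (clauseSet K) ∧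
      p = ⟨s, t.subst fun _ x => x.elim⟩}

/-- `T₀ ⊆ T₀ ∪ K` is a local theory extension. -/
def IsLocal (T₀ : Set (Sentence F P)) (K : Set (Clause (F.sum E) P X)) : Prop :=
  ∀ (C : S → Type u) (G : Set (Clause (F.sum E) P C)), G.Finite →
    (Entails (extModels T₀ K) (clauseSet G) .falsum ↔
      Entails (uifModels T₀ E) (clauseSet (instances K (est K G) ∪ G)) .falsum)

/-! ### Flat and linear clauses -/

/-- A non-ground clause is flat if all arguments of extension symbols are variables. -/
def Clause.IsFlat (D : Clause (F.sum E) P X) : Prop :=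
  ∀ (f : E.Sym) (args : ∀ i, Term (F.sum E) X ((F.sum E).dom (Sum.inr f) i)),
    (⟨_, .app (Sum.inr f) args⟩ : Σ s, Term (F.sum E) X s) ∈ subterms {D.toQF} →
    ∀ i, ∃ x, args i = .var x

/-- Constants: additional constants or function symbols without arguments. -/
def Term.IsConst : ∀ {s : S}, Term F V s → Prop
  | _, .var _ => True
  | _, .app f _ => F.arity f = 0

/-- A ground clause is flat if all arguments of extension symbols are constants. -/
def Clause.IsFlatGround (D : Clause (F.sum E) P C) : Prop :=
  ∀ (f : E.Sym) (args : ∀ i, Term (F.sum E) C ((F.sum E).dom (Sum.inr f) i)),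
    (⟨_, .app (Sum.inr f) args⟩ : Σ s, Term (F.sum E) C s) ∈ subterms {D.toQF} →
    ∀ i, (args i).IsConst

/-- The list of all occurrences of variables and constants in a term. -/
def Term.leaves : ∀ {s : S}, Term F V s → List ((Σ s, V s) ⊕ F.Sym)
  | _, .var x => [.inl ⟨_, x⟩]
  | _, .app f args =>
    if F.arity f = 0 then [.inr f] else (List.ofFn fun i => (args i).leaves).flatten

/-- Linearity (of flat clauses): a variable (or constant) which occurs in two terms starting with an
extension function symbol occurs in identical terms, and no such term contains it twice. -/
def Clause.IsLinear (D : Clause (F.sum E) P V) : Prop :=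
  (∀ p ∈ extTerms {D.toQF}, ∀ q ∈ extTerms {D.toQF}, ¬ p.2.IsConst → ¬ q.2.IsConst →
    ∀ l, l ∈ p.2.leaves → l ∈ q.2.leaves → p = q) ∧
  ∀ p ∈ extTerms {D.toQF}, p.2.leaves.Nodup

/-- Every variable occurs below an extension symbol. -/
def Clause.VarsBelowExt (D : Clause (F.sum E) P X) : Prop :=
  ∀ x ∈ consts {D.toQF}, ∃ p ∈ extTerms {D.toQF}, x ∈ varsIn p.2.subterms

/-! ### The closure operator `Θ_K` and the sort conditions -/

/-- `Θ_K(Σ_s)`: the closure of `Σ_s` under the equivalence relation generated by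
"`f` and `g` occur in a common clause of `K`". -/
def theta (K : Set (Clause (F.sum E) P X)) (Ss : Set E.Sym) : Set E.Sym :=
  {f | ∃ g ∈ Ss,
    Relation.EqvGen (fun f g => ∃ D ∈ K, f ∈ extSyms {D.toQF} ∧ g ∈ extSyms {D.toQF}) f g}

/-- The conditions (A1), (A2) for the partition of the sorts into `S1` and its complement, the
decomposition `Σ = Σ'_s ∪ Σ_1` (with `Σ_1` the complement of `Σ'_s`), and
`K = K_s ∪ K_1`. -/
structure SortConditions (Ks K1 : Set (Clause (F.sum E) P X)) (Ss' : Set E.Sym) (S1 : Set S) :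
    Prop where
  finite_ext : Finite E.Sym
  finite_Ks : Ks.Finite
  finite_K1 : K1.Finite
  flat : ∀ D ∈ Ks ∪ K1, Clause.IsFlat D
  linear : ∀ D ∈ Ks ∪ K1, Clause.IsLinear D
  vars_below : ∀ D ∈ Ks ∪ K1, Clause.VarsBelowExt D
  syms_Ks : extSyms (clauseSet Ks) ⊆ Ss'
  syms_K1 : extSyms (clauseSet K1) ⊆ Ss'ᶜ
  /-- functions of arity at least one have their values in a sort outside `S1` -/
  output : ∀ f : (F.sum E).Sym, 1 ≤ (F.sum E).arity f → (F.sum E).cod f ∉ S1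
  /-- all arguments of the symbols in `Σ'_s` have their sorts in `S1` -/
  input : ∀ f ∈ Ss', ∀ i, E.dom f i ∈ S1
  /-- the only constants of the signature of a sort in `S1` are in `Σ'_s` -/
  base_const : ∀ f : F.Sym, F.arity f = 0 → F.cod f ∉ S1
  ext_const : ∀ f : E.Sym, E.arity f = 0 → E.cod f ∈ S1 → f ∈ Ss'

/-- A constant from `Σ'_s ∪ C`. -/
def IsSharedConst (Ss' : Set E.Sym) {s : S} (t : Term (F.sum E) C s) : Prop :=
  (∃ c : C s, t = .var c) ∨
    ∃ f ∈ Ss', E.arity f = 0 ∧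
      ∃ args, (⟨s, t⟩ : Σ s, Term (F.sum E) C s) = ⟨_, .app (Sum.inr f) args⟩

/-- The set of all terms `f(c₁, …, cₙ)` with `f ∈ Σ'_s` and constants `cᵢ` in `Σ'_s ∪ C`. -/
def sharedTerms (F : FunSig S) (C : S → Type u) (Ss' : Set E.Sym) :
    Set (Σ s, Term (F.sum E) C s) :=
  {p | ∃ f ∈ Ss', ∃ args : ∀ i, Term (F.sum E) C ((F.sum E).dom (Sum.inr f) i),
    (∀ i, IsSharedConst Ss' (args i)) ∧ p = ⟨_, .app (Sum.inr f) args⟩}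

/-! ### Uniform interpolants -/

/-- `ψ` is a general uniform interpolant, with respect to the theory with models `Th`, of (the
conjunction of) `Φ` w.r.t. the extension symbols `Ss` and the constants `Cs`. -/
structure IsGenUniformInterpolant (Th : Set (Struct (F.sum E) P)) (Φ : Set (QF (F.sum E) P C))
    (Ss : Set E.Sym) (Cs : Set (Σ s, C s)) (ψ : QF (F.sum E) P C) : Prop where
  syms : extSyms {ψ} ⊆ Ss
  consts : consts {ψ} ⊆ Cs
  entails : Entails Th Φ ψ
  strongest : ∀ θ : QF (F.sum E) P C,
    extSyms {θ} ∩ extSyms Φ ⊆ Ss → ManySorted.consts {θ} ∩ ManySorted.consts Φ ⊆ Cs →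
    Entails Th Φ θ → Entails Th {ψ} θ

/-- `ψ` is a uniform interpolant (cover) of `φ` w.r.t. the constants `Cs`, with respect to the
theory with models `Th`, all of whose symbols are regarded as interpreted. The formula `θ` may
contain arbitrarily many further constants `Z`. -/
structure IsUniformInterpolant (Th : Set (Struct F P)) (φ : QF F P C) (Cs : Set (Σ s, C s))
    (ψ : QF F P C) : Prop where
  consts : consts {ψ} ⊆ Cs
  entails : Entails Th {φ} ψ
  strongest : ∀ (Z : S → Type u) (θ : QF F P fun s => C s ⊕ Z s),
    (∀ s (c : C s), (⟨s, Sum.inl c⟩ : Σ s, C s ⊕ Z s) ∈ ManySorted.consts {θ} →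
      (⟨s, c⟩ : Σ s, C s) ∈ ManySorted.consts {φ} → (⟨s, c⟩ : Σ s, C s) ∈ Cs) →
    Entails Th {φ.subst fun _ c => .var (Sum.inl c)} θ →
    Entails Th {ψ.subst fun _ c => .var (Sum.inl c)} θ

/-! ### The algorithm for function elimination -/

/-- The constants available after purification: the constants `C`, and a constant `c_t`
for each ground extension term `t`. -/
def PureConst (F E : FunSig S) (C : S → Type u) : S → Type u :=
  fun s => C s ⊕ {t : Term (F.sum E) C s // t.IsExt}

/-- Replace all maximal extension terms `t` by the constants `c_t`. -/
def Term.purify : ∀ {s : S}, Term (F.sum E) C s → Term F (PureConst F E C) s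
  | _, .var c => .var (Sum.inl c)
  | _, .app (Sum.inl f) args => .app (F := F) f fun i => (args i).purify
  | _, .app (Sum.inr f) args => .var (Sum.inr ⟨.app (F := F.sum E) (Sum.inr f) args, trivial⟩)

def Atom.purify : Atom (F.sum E) P C → Atom F P (PureConst F E C)
  | .eq t t' => .eq t.purify t'.purify
  | .rel p args => .rel p fun i => (args i).purify

def Literal.purify : Literal (F.sum E) P C → Literal F P (PureConst F E C)
  | .pos a => .pos a.purify
  | .neg a => .neg a.purify

def Clause.purify (D : Clause (F.sum E) P C) : Clause F P (PureConst F E C) :=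
  List.map Literal.purify D

/-- `Con₀`: the congruence axioms `⋀ cᵢ ≈ dᵢ → c_t ≈ c_t'` for the definitions
`c_t ≈ f(c₁, …, cₙ)` and `c_t' ≈ f(d₁, …, dₙ)` of extension terms in `Def`. -/
def conClauses (P : RelSig S) (Def : Set (Σ s, Term (F.sum E) C s)) :
    Set (Clause F P (PureConst F E C)) :=
  {D | ∃ (f : E.Sym) (a b : ∀ i, Term (F.sum E) C ((F.sum E).dom (Sum.inr f) i)),
    (⟨_, .app (Sum.inr f) a⟩ : Σ s, Term (F.sum E) C s) ∈ Def ∧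
    (⟨_, .app (Sum.inr f) b⟩ : Σ s, Term (F.sum E) C s) ∈ Def ∧
    D = (List.ofFn fun i => Literal.neg (.eq (a i).purify (b i).purify)) ++
      [Literal.pos (.eq (Term.purify (.app (F := F.sum E) (Sum.inr f) a))
        (Term.purify (.app (F := F.sum E) (Sum.inr f) b)))]}

/-- Step 1: `K₀ ∪ G₀ ∪ Con₀`, obtained by purification from `K[T] ∪ G`. -/
def stepOne (K : Set (Clause (F.sum E) P X)) (G : Set (Clause (F.sum E) P C))
    (T : Set (Σ s, Term (F.sum E) C s)) : Set (Clause F P (PureConst F E C)) :=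
  Clause.purify '' (instances K T ∪ G) ∪ conClauses P (extTerms (clauseSet (instances K T ∪ G)))

/-- The constants in `Cs`, together with all constants of `C` which are arguments of a
function in `Ss` in a term of the set `Def`. -/
def keptConsts (Def : Set (Σ s, Term (F.sum E) C s)) (Ss : Set E.Sym) (Cs : Set (Σ s, C s)) :
    Set (Σ s, C s) :=
  Cs ∪ {c | ∃ f ∈ Ss, ∃ args : ∀ i, Term (F.sum E) C ((F.sum E).dom (Sum.inr f) i),
    (⟨_, .app (Sum.inr f) args⟩ : Σ s, Term (F.sum E) C s) ∈ Def ∧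
    ∃ i, (⟨c.1, .var c.2⟩ : Σ s, Term (F.sum E) C s) = ⟨_, args i⟩}

/-- Step 2: the constants which are not eliminated, namely the constants in `Cs`, the constants
`c_t` defined by a term `t` in `Def` with root symbol in `Ss`, and the arguments of such `t`. -/
def Keep (Def : Set (Σ s, Term (F.sum E) C s)) (Ss : Set E.Sym) (Cs : Set (Σ s, C s)) (s : S) :
    PureConst F E C s → Prop
  | .inl c => (⟨s, c⟩ : Σ s, C s) ∈ keptConsts Def Ss Cs
  | .inr t => (⟨s, t.1⟩ : Σ s, Term (F.sum E) C s) ∈ Def ∧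
      ∃ f ∈ Ss, ∃ args, (⟨s, t.1⟩ : Σ s, Term (F.sum E) C s) = ⟨_, .app (Sum.inr f) args⟩

/-- Step 4: replacing the constants `c_t` back by the terms `t`. -/
def PureConst.back {s : S} : PureConst F E C s → Term (F.sum E) C s
  | .inl c => .var c
  | .inr t => t.1

/-- Substituting terms of the extended signature in terms of the base signature. -/
def Term.lift (σ : ∀ s, V s → Term (F.sum E) C s) : ∀ {s : S}, Term F V s → Term (F.sum E) C s
  | _, .var x => σ _ x
  | _, .app f args => .app (F := F.sum E) (Sum.inl f) fun i => (args i).lift σ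

def Atom.lift (σ : ∀ s, V s → Term (F.sum E) C s) : Atom F P V → Atom (F.sum E) P C
  | .eq t t' => .eq (t.lift σ) (t'.lift σ)
  | .rel p args => .rel p fun i => (args i).lift σ

def QF.lift (σ : ∀ s, V s → Term (F.sum E) C s) : QF F P V → QF (F.sum E) P C
  | .falsum => .falsum
  | .atom a => .atom (a.lift σ)
  | .neg φ => .neg (φ.lift σ)
  | .conj φ ψ => .conj (φ.lift σ) (ψ.lift σ)
  | .disj φ ψ => .disj (φ.lift σ) (ψ.lift σ)

/-- `Γ` is a result of the algorithm for function elimination, applied to the extension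
`T₀ ⊆ T₀ ∪ K`, the ground clauses `G`, the set `T` of terms used for instantiation, and the symbols
`Ss` and constants `Cs` to be kept: `Γ₁` is a quantifier-free base formula in the kept constants
which is equivalent modulo `T₀` to the formula obtained from `K₀ ∪ G₀ ∪ Con₀` by existentially
quantifying over all other constants (Step 3), and `Γ` is `Γ₁` with the terms put back (Step 4). -/
def IsEliminationResult (T₀ : Set (Sentence F P)) (K : Set (Clause (F.sum E) P X))
    (G : Set (Clause (F.sum E) P C)) (T : Set (Σ s, Term (F.sum E) C s))
    (Ss : Set E.Sym) (Cs : Set (Σ s, C s)) (Γ : QF (F.sum E) P C) : Prop :=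
  ∃ Γ₁ : QF F P fun s => {c : PureConst F E C s //
      Keep (extTerms (clauseSet (instances K T ∪ G))) Ss Cs s c},
    (∀ M ∈ models T₀, ∀ v : M.Val _, Γ₁.Realize M v ↔
      ∃ w : M.Val (PureConst F E C), (∀ s c, w s c.1 = v s c) ∧
        ∀ D ∈ stepOne K G T, Clause.Realize M w D) ∧
    Γ = Γ₁.lift fun _ c => c.1.back

end Extensions

end ManySorted

open ManySorted

namespace ManySorted

variable {S : Type u} {F E : FunSig S} {P : RelSig S} {V W X C : S → Type u}

/-! ### Semantics of substitutions, clauses and finite conjunctions -/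

/-! Write `H` for `G ∧ Ks[T]`. The sort conditions leave no base function with values in a sort of
`S1`, so a ground term of such a sort is a constant of `C` or a nullary symbol of `Ss'`
(`SortConditions.isSharedConst`). All arguments of symbols in `Ss'` have these sorts. Hence `T` is
finite, and `Ks[T]` already contains every ground instance of `Ks`
(`SortConditions.subst_mem_instances`).

Each "strongest" claim is proved by building a model. To pass from `T₀ ∪ K1` to the full theory,
take a model of `T₀ ∪ K1` in which `H` holds and `θ` fails. The instances of `Ks` required by
locality are in `Ks[T]` and those of `K1` hold in the model, so `G ∧ ¬θ` has a model of the whole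
theory (`exists_model_of_isLocal`, `IsGenUniformInterpolant.of_instances`).

For `Γ`, let `L` be clauses for `¬θ` and let `R` be `K1[est(K1, L)]`. If `H` entails `θ` modulo `T₀
∪ K1`, then `Γ` entails `R → θ` with all extension symbols uninterpreted
(`eq_true_of_eliminationResult`). Otherwise take a countermodel. The eliminated constants have
witnesses, and these are used to redefine the symbols of `H` outside `Ss'`, which makes `H` true. A
clause of `K1` cannot mix symbols of `H` with symbols foreign to `H`, because of the closure
hypothesis on `theta`. So each relevant instance is controlled either by the purified formula or by
`R`, and locality gives a model of `H ∧ ¬θ`. A uniform interpolant `ψ` of `Γ` therefore entails `R →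
θ`, and `R` is true in all models of `K1`.

Existence of `ψ` (`exists_uniformInterpolant`) again uses purification and quantifier elimination.
The obstacle is that the witness of an eliminated constant may coincide with an argument value in
`θ`, so that redefining a function would disturb `θ`. Quantifier elimination and equality
interpolation remove it (`exists_move_values`): a value forced into a finite set would be definable,
hence named by a term over the parameters. In a sort that no base function reaches, such a term is
itself a parameter. -/

theorem Term.eval_subst (M : Struct F P) (v : M.Val W) (σ : ∀ s, V s → Term F W s) {s : S}
    (t : Term F V s) :
    (t.subst σ).eval M v = t.eval M fun s x => (σ s x).eval M v := by
  induction t with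
  | var x => rfl
  | app f args ih => exact congrArg (M.fn f) (funext fun i => ih i)

theorem Atom.realize_subst (M : Struct F P) (v : M.Val W) (σ : ∀ s, V s → Term F W s)
    (a : Atom F P V) :
    (a.subst σ).Realize M v ↔ a.Realize M fun s x => (σ s x).eval M v := by
  cases a with
  | eq t t' => simp only [Atom.subst, Atom.Realize, Term.eval_subst]
  | rel p args => simp only [Atom.subst, Atom.Realize, Term.eval_subst]

theorem Literal.realize_subst (M : Struct F P) (v : M.Val W) (σ : ∀ s, V s → Term F W s)
    (l : Literal F P V) :
    (l.subst σ).Realize M v ↔ l.Realize M fun s x => (σ s x).eval M v := by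
  cases l with
  | pos a => exact a.realize_subst M v σ
  | neg a => exact not_congr (a.realize_subst M v σ)

theorem QF.realize_subst (M : Struct F P) (v : M.Val W) (σ : ∀ s, V s → Term F W s)
    (φ : QF F P V) :
    (φ.subst σ).Realize M v ↔ φ.Realize M fun s x => (σ s x).eval M v := by
  induction φ with
  | falsum => rfl
  | atom a => exact a.realize_subst M v σ
  | neg φ ih => exact not_congr ih
  | conj φ ψ ih ih' => exact and_congr ih ih'
  | disj φ ψ ih ih' => exact or_congr ih ih'

theorem Literal.realize_toQF (M : Struct F P) (v : M.Val V) (l : Literal F P V) :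
    l.toQF.Realize M v ↔ l.Realize M v := by
  cases l <;> rfl

theorem Clause.realize_toQF (M : Struct F P) (v : M.Val V) (D : Clause F P V) :
    (Clause.toQF D).Realize M v ↔ Clause.Realize M v D := by
  induction D with
  | nil => simp [Clause.toQF, Clause.Realize, QF.Realize]
  | cons l D ih =>
    have : (Clause.toQF (l :: D)).Realize M v ↔
        l.toQF.Realize M v ∨ (Clause.toQF D).Realize M v := Iff.rfl
    rw [this, ih, Literal.realize_toQF]
    simp [Clause.Realize]

theorem Clause.realize_subst (M : Struct F P) (v : M.Val W) (σ : ∀ s, V s → Term F W s)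
    (D : Clause F P V) :
    Clause.Realize M v (Clause.subst σ D) ↔
      Clause.Realize M (fun s x => (σ s x).eval M v) D := by
  simp only [Clause.Realize, Clause.subst, List.mem_map, exists_exists_and_eq_and,
    Literal.realize_subst]

theorem Clause.toQF_subst (σ : ∀ s, V s → Term F W s) (D : Clause F P V) :
    Clause.toQF (Clause.subst σ D) = (Clause.toQF D).subst σ := by
  induction D with
  | nil => rfl
  | cons l D ih =>
    have : Clause.toQF (Clause.subst σ (l :: D)) =
      .disj (l.subst σ).toQF (Clause.toQF (Clause.subst σ D)) := rfl
    rw [this, ih]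
    cases l <;> rfl

theorem forall_clauseSet {Q : QF F P V → Prop} {H : Set (Clause F P V)} :
    (∀ φ ∈ clauseSet H, Q φ) ↔ ∀ D ∈ H, Q (Clause.toQF D) :=
  Set.forall_mem_image

theorem realize_clauseSet (M : Struct F P) (v : M.Val V) (H : Set (Clause F P V)) :
    (∀ φ ∈ clauseSet H, φ.Realize M v) ↔ ∀ D ∈ H, Clause.Realize M v D := by
  simp only [forall_clauseSet, Clause.realize_toQF]

theorem Term.eval_lift (M : Struct (F.sum E) P) (v : M.Val C)
    (σ : ∀ s, V s → Term (F.sum E) C s) {s : S} (t : Term F V s) :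
    (t.lift σ).eval M v = t.eval M.reduct fun s x => (σ s x).eval M v := by
  induction t with
  | var x => rfl
  | app f args ih => exact congrArg (M.fn (Sum.inl f)) (funext fun i => ih i)

theorem Atom.realize_lift (M : Struct (F.sum E) P) (v : M.Val C)
    (σ : ∀ s, V s → Term (F.sum E) C s) (a : Atom F P V) :
    (a.lift σ).Realize M v ↔ a.Realize M.reduct fun s x => (σ s x).eval M v := by
  cases a with
  | eq t t' =>
    simp only [Atom.lift, Atom.Realize, Term.eval_lift]
    rfl
  | rel p args =>
    simp only [Atom.lift, Atom.Realize, Term.eval_lift]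
    rfl

theorem QF.realize_lift (M : Struct (F.sum E) P) (v : M.Val C)
    (σ : ∀ s, V s → Term (F.sum E) C s) (φ : QF F P V) :
    (φ.lift σ).Realize M v ↔ φ.Realize M.reduct fun s x => (σ s x).eval M v := by
  induction φ with
  | falsum => rfl
  | atom a => exact a.realize_lift M v σ
  | neg φ ih => exact not_congr ih
  | conj φ ψ ih ih' => exact and_congr ih ih'
  | disj φ ψ ih ih' => exact or_congr ih ih'

/-! ### Subterms -/

theorem Term.mem_subterms_self {s : S} (t : Term F V s) :
    (⟨s, t⟩ : Σ s, Term F V s) ∈ t.subterms := by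
  cases t with
  | var x => exact rfl
  | app f args => exact Or.inl rfl

theorem Term.arg_subterms_subset (f : F.Sym) (args : ∀ i, Term F V (F.dom f i)) (i) :
    (args i).subterms ⊆ (Term.app f args).subterms :=
  fun _ h => Or.inr (Set.mem_iUnion.2 ⟨i, h⟩)

theorem Term.arg_mem_subterms (f : F.Sym) (args : ∀ i, Term F V (F.dom f i)) (i) :
    (⟨_, args i⟩ : Σ s, Term F V s) ∈ (Term.app f args).subterms :=
  Term.arg_subterms_subset f args i (args i).mem_subterms_self

theorem Term.subterms_subset {s : S} (t : Term F V s) {p : Σ s, Term F V s}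
    (hp : p ∈ t.subterms) : p.2.subterms ⊆ t.subterms := by
  induction t with
  | var x =>
    cases hp
    exact subset_rfl
  | app f args ih =>
    rcases hp with rfl | hp
    · exact subset_rfl
    · obtain ⟨i, hi⟩ := Set.mem_iUnion.1 hp
      exact (ih i hi).trans (Term.arg_subterms_subset f args i)

theorem Atom.subterms_subset (a : Atom F P V) {p : Σ s, Term F V s}
    (hp : p ∈ a.subterms) : p.2.subterms ⊆ a.subterms := by
  cases a with
  | eq t t' =>
    rcases hp with hp | hp
    · exact (t.subterms_subset hp).trans Set.subset_union_left
    · exact (t'.subterms_subset hp).trans Set.subset_union_right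
  | rel r args =>
    obtain ⟨i, hi⟩ := Set.mem_iUnion.1 hp
    exact ((args i).subterms_subset hi).trans (Set.subset_iUnion (fun i => (args i).subterms) i)

theorem QF.subterms_subset (φ : QF F P V) {p : Σ s, Term F V s}
    (hp : p ∈ φ.subterms) : p.2.subterms ⊆ φ.subterms := by
  induction φ with
  | falsum => exact hp.elim
  | atom a => exact a.subterms_subset hp
  | neg φ ih => exact ih hp
  | conj φ ψ ih ih' =>
    rcases hp with hp | hp
    · exact (ih hp).trans Set.subset_union_left
    · exact (ih' hp).trans Set.subset_union_right
  | disj φ ψ ih ih' =>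
    rcases hp with hp | hp
    · exact (ih hp).trans Set.subset_union_left
    · exact (ih' hp).trans Set.subset_union_right

@[simp] theorem subterms_singleton (φ : QF F P V) : subterms {φ} = φ.subterms := by
  simp [subterms]

theorem mem_subterms {Φ : Set (QF F P V)} {p : Σ s, Term F V s} :
    p ∈ subterms Φ ↔ ∃ φ ∈ Φ, p ∈ φ.subterms := by
  simp [subterms]

theorem subterms_subset {Φ : Set (QF F P V)} {p : Σ s, Term F V s} (hp : p ∈ subterms Φ) :
    p.2.subterms ⊆ subterms Φ := by
  obtain ⟨φ, hφ, hp⟩ := mem_subterms.1 hp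
  exact fun q hq => mem_subterms.2 ⟨φ, hφ, φ.subterms_subset hp hq⟩

theorem subterms_union (Φ Ψ : Set (QF F P V)) : subterms (Φ ∪ Ψ) = subterms Φ ∪ subterms Ψ :=
  Set.biUnion_union Φ Ψ QF.subterms

theorem clauseSet_union (H H' : Set (Clause F P V)) :
    clauseSet (H ∪ H') = clauseSet H ∪ clauseSet H' :=
  Set.image_union _ _ _

theorem subterms_clause_subset {H : Set (Clause F P V)} {D : Clause F P V} (hD : D ∈ H) :
    (Clause.toQF D).subterms ⊆ subterms (clauseSet H) :=
  fun _ hp => mem_subterms.2 ⟨_, ⟨D, hD, rfl⟩, hp⟩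

theorem mem_subterms_clauseSet {H : Set (Clause F P V)} {p : Σ s, Term F V s} :
    p ∈ subterms (clauseSet H) ↔ ∃ D ∈ H, p ∈ (Clause.toQF D).subterms := by
  rw [mem_subterms]
  exact Set.exists_mem_image

theorem Term.finite_subterms {s : S} (t : Term F V s) : t.subterms.Finite := by
  induction t with
  | var x => exact Set.finite_singleton _
  | app f args ih => exact (Set.finite_iUnion ih).insert _

theorem Atom.finite_subterms (a : Atom F P V) : a.subterms.Finite := by
  cases a with
  | eq t t' => exact t.finite_subterms.union t'.finite_subterms
  | rel r args => exact Set.finite_iUnion fun i => (args i).finite_subterms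

theorem QF.finite_subterms (φ : QF F P V) : φ.subterms.Finite := by
  induction φ with
  | falsum => exact Set.finite_empty
  | atom a => exact a.finite_subterms
  | neg φ ih => exact ih
  | conj φ ψ ih ih' => exact ih.union ih'
  | disj φ ψ ih ih' => exact ih.union ih'

theorem finite_subterms {Φ : Set (QF F P V)} (h : Φ.Finite) : (subterms Φ).Finite :=
  h.biUnion fun φ _ => φ.finite_subterms

theorem finite_varsIn {T : Set (Σ s, Term F V s)} (h : T.Finite) : (varsIn T).Finite := by
  refine (h.preimage (f := fun c : Σ s, V s => (⟨c.1, .var c.2⟩ : Σ s, Term F V s)) ?_)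
  rintro ⟨s, c⟩ - ⟨s', c'⟩ - h
  cases h
  rfl

/-! ### Subterms of instances -/

theorem Term.subst_mem_subterms (σ : ∀ s, V s → Term F W s) {s : S} (t : Term F V s)
    {p : Σ s, Term F V s} (hp : p ∈ t.subterms) :
    (⟨p.1, p.2.subst σ⟩ : Σ s, Term F W s) ∈ (t.subst σ).subterms := by
  induction t with
  | var x =>
    cases hp
    exact Term.mem_subterms_self _
  | app f args ih =>
    rcases hp with rfl | hp
    · exact Term.mem_subterms_self _
    · obtain ⟨i, hi⟩ := Set.mem_iUnion.1 hp
      exact Term.arg_subterms_subset f _ i (ih i hi)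

theorem QF.subst_mem_subterms (σ : ∀ s, V s → Term F W s) (φ : QF F P V)
    {p : Σ s, Term F V s} (hp : p ∈ φ.subterms) :
    (⟨p.1, p.2.subst σ⟩ : Σ s, Term F W s) ∈ (φ.subst σ).subterms := by
  induction φ with
  | falsum => exact hp.elim
  | atom a =>
    cases a with
    | eq t t' => exact hp.imp (t.subst_mem_subterms σ) (t'.subst_mem_subterms σ)
    | rel r args =>
      obtain ⟨i, hi⟩ := Set.mem_iUnion.1 hp
      exact Set.mem_iUnion.2 ⟨i, (args i).subst_mem_subterms σ hi⟩
  | neg φ ih => exact ih hp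
  | conj φ ψ ih ih' => exact hp.imp ih ih'
  | disj φ ψ ih ih' => exact hp.imp ih ih'

/-- A subterm of an instance of an expression with subterms `U` comes either from the expression
or from the substitution. -/
def FromSubst (σ : ∀ s, V s → Term F W s) (U : Set (Σ s, Term F V s)) (q : Σ s, Term F W s) :
    Prop :=
  (∃ (f : F.Sym) (args : ∀ i, Term F V (F.dom f i)),
    (⟨_, .app f args⟩ : Σ s, Term F V s) ∈ U ∧ q = ⟨_, (Term.app f args).subst σ⟩) ∨
  ∃ (s : S) (x : V s), (⟨s, .var x⟩ : Σ s, Term F V s) ∈ U ∧ q ∈ (σ s x).subterms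

theorem FromSubst.mono {σ : ∀ s, V s → Term F W s} {U U' : Set (Σ s, Term F V s)}
    {q : Σ s, Term F W s} (h : FromSubst σ U q) (hU : U ⊆ U') : FromSubst σ U' q := by
  rcases h with ⟨f, args, h, e⟩ | ⟨s, x, h, e⟩
  · exact Or.inl ⟨f, args, hU h, e⟩
  · exact Or.inr ⟨s, x, hU h, e⟩

theorem Term.fromSubst (σ : ∀ s, V s → Term F W s) {s : S} (t : Term F V s)
    {q : Σ s, Term F W s} (hq : q ∈ (t.subst σ).subterms) : FromSubst σ t.subterms q := by
  induction t with
  | var x => exact Or.inr ⟨_, x, rfl, hq⟩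
  | app f args ih =>
    rcases hq with rfl | hq
    · exact Or.inl ⟨f, args, Or.inl rfl, rfl⟩
    · obtain ⟨i, hi⟩ := Set.mem_iUnion.1 hq
      exact (ih i hi).mono (Term.arg_subterms_subset f args i)

theorem QF.fromSubst (σ : ∀ s, V s → Term F W s) (φ : QF F P V)
    {q : Σ s, Term F W s} (hq : q ∈ (φ.subst σ).subterms) : FromSubst σ φ.subterms q := by
  induction φ with
  | falsum => exact hq.elim
  | atom a =>
    cases a with
    | eq t t' =>
      rcases hq with hq | hq
      · exact (t.fromSubst σ hq).mono Set.subset_union_left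
      · exact (t'.fromSubst σ hq).mono Set.subset_union_right
    | rel r args =>
      obtain ⟨i, hi⟩ := Set.mem_iUnion.1 hq
      exact ((args i).fromSubst σ hi).mono (Set.subset_iUnion (fun i => (args i).subterms) i)
  | neg φ ih => exact ih hq
  | conj φ ψ ih ih' =>
    rcases hq with hq | hq
    · exact (ih hq).mono Set.subset_union_left
    · exact (ih' hq).mono Set.subset_union_right
  | disj φ ψ ih ih' =>
    rcases hq with hq | hq
    · exact (ih hq).mono Set.subset_union_left
    · exact (ih' hq).mono Set.subset_union_right

/-- A subterm of a lifted base term is a base function application or comes from the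
substitution. -/
def FromLift (σ : ∀ s, V s → Term (F.sum E) C s) (q : Σ s, Term (F.sum E) C s) : Prop :=
  (∃ (f : F.Sym) (args : ∀ i, Term (F.sum E) C ((F.sum E).dom (Sum.inl f) i)),
    q = ⟨_, Term.app (F := F.sum E) (Sum.inl f) args⟩) ∨
  ∃ (s : S) (x : V s), q ∈ (σ s x).subterms

theorem Term.fromLift (σ : ∀ s, V s → Term (F.sum E) C s) {s : S} (t : Term F V s)
    {q : Σ s, Term (F.sum E) C s} (hq : q ∈ (t.lift σ).subterms) : FromLift σ q := by
  induction t with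
  | var x => exact Or.inr ⟨_, x, hq⟩
  | app f args ih =>
    rcases hq with rfl | hq
    · exact Or.inl ⟨f, _, rfl⟩
    · obtain ⟨i, hi⟩ := Set.mem_iUnion.1 hq
      exact ih i hi

theorem QF.fromLift (σ : ∀ s, V s → Term (F.sum E) C s) (φ : QF F P V)
    {q : Σ s, Term (F.sum E) C s} (hq : q ∈ (φ.lift σ).subterms) : FromLift σ q := by
  induction φ with
  | falsum => exact hq.elim
  | atom a =>
    cases a with
    | eq t t' =>
      rcases hq with hq | hq
      · exact t.fromLift σ hq
      · exact t'.fromLift σ hq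
    | rel r args =>
      obtain ⟨i, hi⟩ := Set.mem_iUnion.1 hq
      exact (args i).fromLift σ hi
  | neg φ ih => exact ih hq
  | conj φ ψ ih ih' =>
    rcases hq with hq | hq
    · exact ih hq
    · exact ih' hq
  | disj φ ψ ih ih' =>
    rcases hq with hq | hq
    · exact ih hq
    · exact ih' hq

/-! ### Finite conjunctions, normal forms, restriction of the variables -/

theorem exists_conj {Φ : Set (QF F P V)} (hΦ : Φ.Finite) :
    ∃ φ : QF F P V, φ.subterms = subterms Φ ∧
      ∀ (M : Struct F P) (v : M.Val V), φ.Realize M v ↔ ∀ ψ ∈ Φ, ψ.Realize M v := by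
  induction Φ, hΦ using Set.Finite.induction_on with
  | empty =>
    exact ⟨.neg .falsum, by simp [subterms, QF.subterms], by simp [QF.Realize]⟩
  | @insert ψ Φ _ _ ih =>
    obtain ⟨φ, hφ, h⟩ := ih
    refine ⟨.conj ψ φ, ?_, fun M v => ?_⟩
    · rw [Set.insert_eq, subterms_union, ← hφ, subterms_singleton]
      rfl
    · rw [Set.forall_mem_insert, ← h]
      rfl

/-- Locality speaks of clauses, whereas `θ` is an arbitrary ground formula, so `¬θ` is turned into
clauses without creating new terms. Treating a formula and its negation together lets negation
simply swap the two halves in the induction. -/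
theorem exists_cnf (φ : QF F P V) :
    (∃ L : Set (Clause F P V), L.Finite ∧ subterms (clauseSet L) ⊆ φ.subterms ∧
      ∀ (M : Struct F P) (v : M.Val V),
        (∀ D ∈ L, Clause.Realize M v D) ↔ φ.Realize M v) ∧
    ∃ L : Set (Clause F P V), L.Finite ∧ subterms (clauseSet L) ⊆ φ.subterms ∧
      ∀ (M : Struct F P) (v : M.Val V),
        (∀ D ∈ L, Clause.Realize M v D) ↔ ¬ φ.Realize M v := by
  -- The union of the two clause sets serves the conjunction, the pairwise concatenations serve the
  -- disjunction. By De Morgan the two are exchanged under negation.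
  have key : ∀ {φ φ₁ φ₂ : QF F P V} {A B : ∀ M : Struct F P, M.Val V → Prop},
      φ.subterms = φ₁.subterms ∪ φ₂.subterms →
      (∃ L : Set (Clause F P V), L.Finite ∧ subterms (clauseSet L) ⊆ φ₁.subterms ∧
        ∀ (M : Struct F P) (v : M.Val V), (∀ D ∈ L, Clause.Realize M v D) ↔ A M v) →
      (∃ L : Set (Clause F P V), L.Finite ∧ subterms (clauseSet L) ⊆ φ₂.subterms ∧
        ∀ (M : Struct F P) (v : M.Val V), (∀ D ∈ L, Clause.Realize M v D) ↔ B M v) →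
      (∃ L : Set (Clause F P V), L.Finite ∧ subterms (clauseSet L) ⊆ φ.subterms ∧
        ∀ (M : Struct F P) (v : M.Val V), (∀ D ∈ L, Clause.Realize M v D) ↔ A M v ∧ B M v) ∧
      (∃ L : Set (Clause F P V), L.Finite ∧ subterms (clauseSet L) ⊆ φ.subterms ∧
        ∀ (M : Struct F P) (v : M.Val V),
          (∀ D ∈ L, Clause.Realize M v D) ↔ A M v ∨ B M v) := by
    rintro φ φ₁ φ₂ A B e ⟨L, hf, hs, hL⟩ ⟨L', hf', hs', hL'⟩
    refine ⟨⟨L ∪ L', hf.union hf', ?_, fun M v => ?_⟩,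
      ⟨Set.image2 (fun D D' : Clause F P V => (D ++ D' : List _)) L L', hf.image2 _ hf', ?_,
        fun M v => ?_⟩⟩
    · rw [clauseSet_union, subterms_union, e]
      exact Set.union_subset_union hs hs'
    · rw [← hL, ← hL']
      simp only [Set.mem_union, or_imp, forall_and]
    · intro p hp
      obtain ⟨_, ⟨D, hD, D', hD', rfl⟩, hp⟩ := mem_subterms_clauseSet.1 hp
      have : ∀ D : Clause F P V, p ∈ (Clause.toQF (D ++ D' : List _)).subterms →
          p ∈ (Clause.toQF D).subterms ∪ (Clause.toQF D').subterms := by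
        intro D
        induction D with
        | nil => exact fun h => Or.inr h
        | cons l D ih =>
          rintro (h | h)
          · exact Or.inl (Or.inl h)
          · exact (ih h).imp Or.inr id
      rw [e]
      exact (this D hp).imp (fun h => hs (subterms_clause_subset hD h))
        fun h => hs' (subterms_clause_subset hD' h)
    · rw [← hL, ← hL']
      have : ∀ D D' : Clause F P V, Clause.Realize M v (D ++ D' : List _) ↔
          Clause.Realize M v D ∨ Clause.Realize M v D' := by
        intro D D'
        simp only [Clause.Realize, List.mem_append, or_and_right, exists_or]
      simp only [Set.forall_mem_image2, this]
      constructor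
      · intro h
        by_contra! hc
        obtain ⟨⟨D, hD, h1⟩, D', hD', h2⟩ := hc
        exact (h D hD D' hD').elim h1 h2
      · rintro (h | h) D hD D' hD'
        · exact Or.inl (h D hD)
        · exact Or.inr (h D' hD')
  induction φ with
  | falsum =>
    refine ⟨⟨{[]}, Set.finite_singleton _, ?_, fun M v => ?_⟩, ⟨∅, Set.finite_empty, ?_,
      fun M v => ?_⟩⟩
    · simp [clauseSet, Clause.toQF, QF.subterms]
    · simp [Clause.Realize, QF.Realize]
    · simp [clauseSet, subterms]
    · simp [QF.Realize]
  | atom a =>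
    refine ⟨⟨{[.pos a]}, Set.finite_singleton _, ?_, fun M v => ?_⟩,
      ⟨{[.neg a]}, Set.finite_singleton _, ?_, fun M v => ?_⟩⟩
    · simp [clauseSet, Clause.toQF, QF.subterms, Literal.toQF]
    · simp [Clause.Realize, QF.Realize, Literal.Realize]
    · simp [clauseSet, Clause.toQF, QF.subterms, Literal.toQF]
    · simp [Clause.Realize, QF.Realize, Literal.Realize]
  | neg φ ih =>
    obtain ⟨⟨L, h1, h2, h3⟩, ih'⟩ := ih
    exact ⟨ih', L, h1, h2, fun M v => (h3 M v).trans (by simp [QF.Realize])⟩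
  | conj φ ψ ih ih' =>
    refine ⟨(key rfl ih.1 ih'.1).1, ?_⟩
    obtain ⟨L, h1, h2, h3⟩ := (key (φ := .conj φ ψ) rfl ih.2 ih'.2).2
    exact ⟨L, h1, h2, fun M v => (h3 M v).trans not_and_or.symm⟩
  | disj φ ψ ih ih' =>
    refine ⟨(key rfl ih.1 ih'.1).2, ?_⟩
    obtain ⟨L, h1, h2, h3⟩ := (key (φ := .disj φ ψ) rfl ih.2 ih'.2).1
    exact ⟨L, h1, h2, fun M v => (h3 M v).trans not_or.symm⟩

/-- A true formula is implied by finitely many true literals. -/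
theorem QF.exists_implicant (M : Struct F P) (v : M.Val V) (φ : QF F P V) :
    ∃ A : List (Literal F P V), (∀ l ∈ A, l.Realize M v) ∧
      ∀ (N : Struct F P) (w : N.Val V), (∀ l ∈ A, l.Realize N w) →
        (φ.Realize N w ↔ φ.Realize M v) := by
  induction φ with
  | falsum => exact ⟨[], by simp, fun N w _ => Iff.rfl⟩
  | atom a =>
    by_cases h : a.Realize M v
    · refine ⟨[.pos a], by simpa [Literal.Realize] using h, fun N w hN => ?_⟩
      exact iff_of_true (by simpa [Literal.Realize, QF.Realize] using hN) h
    · refine ⟨[.neg a], by simpa [Literal.Realize] using h, fun N w hN => ?_⟩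
      exact iff_of_false (by simpa [Literal.Realize, QF.Realize] using hN) h
  | neg φ ih =>
    obtain ⟨A, h, h'⟩ := ih
    exact ⟨A, h, fun N w hN => not_congr (h' N w hN)⟩
  | conj φ ψ ih ih' =>
    obtain ⟨A, h, h'⟩ := ih
    obtain ⟨B, k, k'⟩ := ih'
    refine ⟨A ++ B, by simpa [or_imp, forall_and] using ⟨h, k⟩, fun N w hN => ?_⟩
    simp only [List.mem_append, or_imp, forall_and] at hN
    exact and_congr (h' N w hN.1) (k' N w hN.2)
  | disj φ ψ ih ih' =>
    obtain ⟨A, h, h'⟩ := ih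
    obtain ⟨B, k, k'⟩ := ih'
    refine ⟨A ++ B, by simpa [or_imp, forall_and] using ⟨h, k⟩, fun N w hN => ?_⟩
    simp only [List.mem_append, or_imp, forall_and] at hN
    exact or_congr (h' N w hN.1) (k' N w hN.2)

theorem Term.exists_restrict {A : ∀ s, V s → Prop} {s : S} (t : Term F V s)
    (h : ∀ c ∈ varsIn t.subterms, A c.1 c.2) :
    ∃ t' : Term F (fun s => {c : V s // A s c}) s, t'.subst (fun _ c => .var c.1) = t := by
  induction t with
  | var x => exact ⟨.var ⟨x, h ⟨_, x⟩ rfl⟩, rfl⟩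
  | app f args ih =>
    choose args' h' using fun i => ih i fun c hc =>
      h c (Term.arg_subterms_subset f args i hc)
    exact ⟨.app f args', congrArg (Term.app f) (funext h')⟩

theorem QF.exists_restrict {A : ∀ s, V s → Prop} (φ : QF F P V)
    (h : ∀ c ∈ varsIn φ.subterms, A c.1 c.2) :
    ∃ φ' : QF F P (fun s => {c : V s // A s c}), φ'.subst (fun _ c => .var c.1) = φ := by
  induction φ with
  | falsum => exact ⟨.falsum, rfl⟩
  | atom a =>
    cases a with
    | eq t t' =>
      obtain ⟨r, hr⟩ := t.exists_restrict fun c hc => h c (Or.inl hc)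
      obtain ⟨r', hr'⟩ := t'.exists_restrict fun c hc => h c (Or.inr hc)
      exact ⟨.atom (.eq r r'), by rw [← hr, ← hr']; rfl⟩
    | rel r args =>
      choose args' h' using fun i => (args i).exists_restrict fun c hc =>
        h c (Set.mem_iUnion.2 ⟨i, hc⟩)
      exact ⟨.atom (.rel r args'), by
        rw [show args = fun i => _ from funext fun i => (h' i).symm]; rfl⟩
  | neg φ ih =>
    obtain ⟨ψ, hψ⟩ := ih h
    exact ⟨.neg ψ, by rw [← hψ]; rfl⟩
  | conj φ ψ ih ih' =>
    obtain ⟨r, hr⟩ := ih fun c hc => h c (Or.inl hc)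
    obtain ⟨r', hr'⟩ := ih' fun c hc => h c (Or.inr hc)
    exact ⟨.conj r r', by rw [← hr, ← hr']; rfl⟩
  | disj φ ψ ih ih' =>
    obtain ⟨r, hr⟩ := ih fun c hc => h c (Or.inl hc)
    obtain ⟨r', hr'⟩ := ih' fun c hc => h c (Or.inr hc)
    exact ⟨.disj r r', by rw [← hr, ← hr']; rfl⟩

/-! ### Elimination of finitely many existential quantifiers -/

/-- Induction on the set of constants to be removed: one constant becomes a bound variable,
quantifier elimination is applied to `¬∀¬`, and the rest is left to the induction hypothesis. -/
theorem HasQE.exists_eliminate_finite {T : Set (Sentence F P)} (hqe : HasQE T)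
    (A : ∀ s, V s → Prop) {L : Set (Σ s, V s)} (hL : L.Finite) :
    ∀ φ : QF F P fun s => {c : V s // A s c ∨ (⟨s, c⟩ : Σ s, V s) ∈ L},
      ∃ ψ : QF F P fun s => {c : V s // A s c}, ∀ M ∈ models T, ∀ v : M.Val _,
        ψ.Realize M v ↔ ∃ w : M.Val fun s => {c : V s // A s c ∨ (⟨s, c⟩ : Σ s, V s) ∈ L},
          (∀ s (c : {c : V s // A s c}), w s ⟨c.1, Or.inl c.2⟩ = v s c) ∧ φ.Realize M w := by
  classical
  induction L, hL using Set.Finite.induction_on with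
  | empty =>
    intro φ
    refine ⟨φ.subst fun s c => .var ⟨c.1, c.2.resolve_right (Set.notMem_empty _)⟩,
      fun M _ v => ?_⟩
    rw [QF.realize_subst]
    constructor
    · exact fun h => ⟨_, fun s c => rfl, h⟩
    · rintro ⟨w, hw, h⟩
      convert h using 3 with s c
      exact (hw s ⟨c.1, _⟩).symm
  | @insert u L _ _ ih =>
    intro φ
    obtain ⟨s₀, u⟩ := u
    -- The new constant becomes the bound variable unless it is kept anyway by `A` or `L`. In that
    -- case the quantifier is vacuous.
    let ρ : ∀ s, {c : V s // A s c ∨ (⟨s, c⟩ : Σ s, V s) ∈ insert ⟨s₀, u⟩ L} →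
        AddVar (fun s => {c : V s // A s c ∨ (⟨s, c⟩ : Σ s, V s) ∈ L}) s₀ s := fun s c =>
      if h : A s c.1 ∨ (⟨s, c.1⟩ : Σ s, V s) ∈ L then Sum.inl ⟨c.1, h⟩
      else Sum.inr ⟨⟨congrArg Sigma.fst
        ((c.2.resolve_left fun h' => h (Or.inl h')).resolve_right fun h' => h (Or.inr h'))⟩⟩
    have hρ : ∀ s c (h : A s c.1 ∨ (⟨s, c.1⟩ : Σ s, V s) ∈ L), ρ s c = Sum.inl ⟨c.1, h⟩ :=
      fun s c h => dif_pos h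
    have hρ' : ∀ c, ¬ (A s₀ c.1 ∨ (⟨s₀, c.1⟩ : Σ s, V s) ∈ L) → ρ s₀ c = Sum.inr ⟨⟨rfl⟩⟩ :=
      fun c h => dif_neg h
    obtain ⟨ψ₁, hψ₁⟩ := hqe _ (.neg (.all s₀ (.neg (.qf (φ.subst fun s c => .var (ρ s c))))))
    obtain ⟨ψ, hψ⟩ := ih ψ₁
    refine ⟨ψ, fun M hM v => ?_⟩
    rw [hψ M hM v]
    simp only [← hψ₁ M hM, Formula.Realize, not_forall, not_not, QF.realize_subst]
    constructor
    · rintro ⟨w, hw, a, h⟩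
      refine ⟨_, fun s c => ?_, h⟩
      rw [← hw s c]
      change w.add a s (ρ s _) = _
      rw [hρ _ _ (Or.inl c.2)]
      rfl
    · rintro ⟨w, hw, h⟩
      refine ⟨fun s c => w s ⟨c.1, c.2.imp_right fun h => Or.inr h⟩, hw,
        w s₀ ⟨u, Or.inr (Or.inl rfl)⟩, ?_⟩
      convert h using 3 with s c
      change Struct.Val.add _ _ s (ρ s c) = _
      by_cases h' : A s c.1 ∨ (⟨s, c.1⟩ : Σ s, V s) ∈ L
      · rw [hρ _ _ h']
        rfl
      · obtain ⟨c, hc⟩ := c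
        have := (hc.resolve_left fun h'' => h' (Or.inl h'')).resolve_right fun h'' =>
          h' (Or.inr h'')
        cases this
        rw [hρ' _ h']
        rfl

theorem HasQE.exists_eliminate {T : Set (Sentence F P)} (hqe : HasQE T)
    (A : ∀ s, V s → Prop) (φ : QF F P V) :
    ∃ ψ : QF F P fun s => {c : V s // A s c}, ∀ M ∈ models T, ∀ v : M.Val _,
      ψ.Realize M v ↔
        ∃ w : M.Val V, (∀ s (c : {c : V s // A s c}), w s c.1 = v s c) ∧ φ.Realize M w := by
  classical
  obtain ⟨φ', hφ'⟩ := φ.exists_restrict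
    (A := fun s c => A s c ∨ (⟨s, c⟩ : Σ s, V s) ∈ varsIn φ.subterms) fun c hc => Or.inr hc
  have hL := finite_varsIn φ.finite_subterms
  generalize varsIn φ.subterms = L at *
  subst hφ'
  obtain ⟨ψ, hψ⟩ := hqe.exists_eliminate_finite A hL φ'
  refine ⟨ψ, fun M hM v => ?_⟩
  rw [hψ M hM v]
  simp only [QF.realize_subst]
  constructor
  · rintro ⟨w, hw, h⟩
    -- Constants that are neither kept nor occur in the formula get an arbitrary value, which exists
    -- since carriers are non-empty.
    refine ⟨fun s c => if hc : A s c ∨ (⟨s, c⟩ : Σ s, V s) ∈ L then w s ⟨c, hc⟩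
      else Classical.choice (M.nonempty s), fun s c => ?_, ?_⟩
    · exact (dif_pos (Or.inl c.2)).trans (hw s c)
    · convert h using 3 with s c
      simp only [Term.eval]
      rw [dif_pos c.2]
  · rintro ⟨w, hw, h⟩
    exact ⟨fun s c => w s c.1, hw, h⟩

/-! ### Sorts without functions into them -/

/-- Applied to two renamings that share only the parameters, this shows that a constant common to
both renamed lists is a parameter. -/
theorem toQF_subterms_subst_subset {W' : S → Type u} (A : List (Literal F P V))
    (σ : ∀ s, V s → W' s) {c : Σ s, W' s}
    (hc : c ∈ consts {φ | ∃ l ∈ A.map (Literal.subst fun s x => Term.var (σ s x)),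
      φ = l.toQF}) : ∃ x, c.2 = σ c.1 x := by
  obtain ⟨φ, ⟨l, hl, rfl⟩, hc⟩ := mem_subterms.1 hc
  obtain ⟨l, -, rfl⟩ := List.mem_map.1 hl
  have : (l.subst fun s x => Term.var (σ s x)).toQF =
      l.toQF.subst (fun s x => Term.var (σ s x)) := by cases l <;> rfl
  rw [this] at hc
  rcases QF.fromSubst _ _ hc with ⟨f, args, -, h⟩ | ⟨s, x, -, h⟩
  · obtain ⟨s, c⟩ := c
    have h2 : ∀ (p q : Σ s, Term F W' s), p = q → (∃ s x, p = ⟨s, .var x⟩) →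
        ∃ s x, q = ⟨s, .var x⟩ := by rintro p q rfl h; exact h
    obtain ⟨s', x', h3⟩ := h2 _ _ h ⟨_, _, rfl⟩
    cases h3
  · obtain ⟨s', c⟩ := c
    obtain ⟨rfl, h⟩ := Sigma.mk.inj_iff.1 h
    exact ⟨x, Term.var.inj (eq_of_heq h)⟩

/-- A Beth-style argument. Two copies of the description of the unique solution, over the same
parameters, entail that the two solutions are equal. The interpolating term uses only the
parameters, and with no functions into the sort it can only be one of them. -/
theorem exists_eq_of_unique {T : Set (Sentence F P)} (hqe : HasQE T) (heq : IsEqInterpolating T)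
    {s : S} (hs : ∀ f : F.Sym, F.cod f ≠ s) (φ : QF F P (AddVar V s)) {M : Struct F P}
    (hM : M ∈ models T) (v : M.Val V) (y : M.carrier s) (hy : φ.Realize M (v.add y))
    (huniq : ∀ z, φ.Realize M (v.add z) → z = y) : ∃ x : V s, v s x = y := by
  -- `ψ` says that the distinguished variable is the only solution of `φ`. Uniqueness is thereby
  -- part of the formula and holds in all models, not just in `M`.
  obtain ⟨ψ, hψ⟩ := hqe (AddVar V s) (.conj (.qf φ) (.all s (.neg (.qf (.conj
    (φ.subst (W := AddVar (AddVar V s) s) fun _ x => .var (match x with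
      | .inl x => .inl (.inl x)
      | .inr h => .inr h))
    (.neg (.atom (.eq (.var (.inl (.inr ⟨⟨rfl⟩⟩))) (.var (.inr ⟨⟨rfl⟩⟩))))))))))
  have hψ' : ∀ N ∈ models T, ∀ w : N.Val V, ∀ a : N.carrier s, ψ.Realize N (w.add a) ↔
      φ.Realize N (w.add a) ∧ ∀ b, φ.Realize N (w.add b) → a = b := by
    intro N hN w a
    rw [← hψ N hN]
    refine and_congr Iff.rfl (forall_congr' fun b => ?_)
    simp only [Formula.Realize, QF.Realize, not_and, not_not, QF.realize_subst]
    refine imp_congr (iff_of_eq (congrArg (fun v' => QF.Realize N v' φ) ?_)) Iff.rfl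
    funext t x
    rcases x with x | ⟨⟨⟨rfl⟩⟩⟩ <;> rfl
  -- Equality interpolation needs conjunctions of literals, so `ψ` is replaced by literals true at
  -- `y` that imply it.
  obtain ⟨A, hA, hA'⟩ := ψ.exists_implicant M (v.add y)
  have hψy := (hψ' M hM v y).2 ⟨hy, fun b hb => (huniq b hb).symm⟩
  let ρ₁ : ∀ t, AddVar V s t → AddVar (AddVar V s) s t := fun t x => .inl x
  let ρ₂ : ∀ t, AddVar V s t → AddVar (AddVar V s) s t := fun t x => match x with
    | .inl x => .inl (.inl x)
    | .inr h => .inr h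
  -- A trivial equation `y ≈ y`, added so that the distinguished variable does occur in each copy.
  let a₀ : Literal F P (AddVar V s) :=
    .pos (.eq (.var (.inr ⟨⟨rfl⟩⟩ : AddVar V s s)) (.var (.inr ⟨⟨rfl⟩⟩ : AddVar V s s)))
  have key := heq (AddVar (AddVar V s) s)
    ((a₀ :: A).map (Literal.subst fun t x => .var (ρ₁ t x)))
    ((a₀ :: A).map (Literal.subst fun t x => .var (ρ₂ t x))) s
    (.inl (.inr ⟨⟨rfl⟩⟩)) (.inr ⟨⟨rfl⟩⟩)
    (mem_subterms.2 ⟨_, ⟨_, List.mem_cons_self, rfl⟩, Or.inl rfl⟩)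
    (mem_subterms.2 ⟨_, ⟨_, List.mem_cons_self, rfl⟩, Or.inl rfl⟩)
  have h₁ : ∀ (N : Struct F P) (w : N.Val (AddVar (AddVar V s) s)),
      (fun t x => (Term.var (F := F) (ρ₁ t x)).eval N w) =
        Struct.Val.add (fun t x => w t (.inl (.inl x))) (w s (.inl (.inr ⟨⟨rfl⟩⟩))) := by
    intro N w
    funext t x
    rcases x with x | ⟨⟨⟨rfl⟩⟩⟩ <;> rfl
  have h₂ : ∀ (N : Struct F P) (w : N.Val (AddVar (AddVar V s) s)),
      (fun t x => (Term.var (F := F) (ρ₂ t x)).eval N w) =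
        Struct.Val.add (fun t x => w t (.inl (.inl x))) (w s (.inr ⟨⟨rfl⟩⟩)) := by
    intro N w
    funext t x
    rcases x with x | ⟨⟨⟨rfl⟩⟩⟩ <;> rfl
  have r₁ : ∀ (N : Struct F P) (w : N.Val (AddVar (AddVar V s) s)),
      (∀ l ∈ (a₀ :: A).map (Literal.subst fun t x => .var (ρ₁ t x)), l.Realize N w) ↔
        ∀ l ∈ A, l.Realize N
          (Struct.Val.add (fun t x => w t (.inl (.inl x))) (w s (.inl (.inr ⟨⟨rfl⟩⟩)))) := by
    intro N w
    simp only [List.forall_mem_map, Literal.realize_subst, h₁]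
    exact List.forall_mem_cons.trans (and_iff_right rfl)
  have r₂ : ∀ (N : Struct F P) (w : N.Val (AddVar (AddVar V s) s)),
      (∀ l ∈ (a₀ :: A).map (Literal.subst fun t x => .var (ρ₂ t x)), l.Realize N w) ↔
        ∀ l ∈ A, l.Realize N
          (Struct.Val.add (fun t x => w t (.inl (.inl x))) (w s (.inr ⟨⟨rfl⟩⟩))) := by
    intro N w
    simp only [List.forall_mem_map, Literal.realize_subst, h₂]
    exact List.forall_mem_cons.trans (and_iff_right rfl)
  simp only [r₁, r₂] at key
  obtain ⟨t, ht, hAB⟩ := key ⟨M, hM, (v.add y).add y, hA, hA⟩ fun N hN w hw hw' =>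
    ((hψ' N hN _ _).1 ((hA' N _ hw).2 hψy)).2 _
      ((hψ' N hN _ _).1 ((hA' N _ hw').2 hψy)).1
  obtain ⟨x, rfl⟩ : ∃ x, t = .var x := by
    cases t with
    | var x => exact ⟨x, rfl⟩
    | app f args => exact (hs f rfl).elim
  have hx := ht (show (⟨s, x⟩ : Σ s, _) ∈ varsIn _ from rfl)
  obtain ⟨x₁, hx₁⟩ := toQF_subterms_subst_subset _ _ hx.1
  obtain ⟨x₂, hx₂⟩ := toQF_subterms_subst_subset _ _ hx.2
  have hval := (hAB M hM ((v.add y).add y) hA hA).1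
  dsimp only at hx₁ hx₂
  rw [hx₁] at hx₂ hval
  -- The common constant lies in the ranges of both renamings. It is thus neither of the two copies
  -- of the distinguished variable, but a parameter.
  rcases x₂ with x₂ | x₂
  · cases hx₂
    exact ⟨x₂, hval.symm⟩
  · cases hx₂

/-- In a sort without functions into it, a value of a solution of a formula can be moved away from
any finite set. -/
theorem exists_move_value {T : Set (Sentence F P)} (hqe : HasQE T) (heq : IsEqInterpolating T)
    {s : S} (hs : ∀ f : F.Sym, F.cod f ≠ s) (φ : QF F P V) {M : Struct F P}
    (hM : M ∈ models T) (w : M.Val V) (hw : φ.Realize M w) (y : M.carrier s)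
    {B : Set (Σ s, M.carrier s)} (hB : B.Finite) :
    ∃ r : ∀ t, M.carrier t → M.carrier t,
      (∀ t m, (⟨t, m⟩ : Σ s, M.carrier s) ≠ ⟨s, y⟩ → r t m = m) ∧
      (⟨s, r s y⟩ : Σ s, M.carrier s) ∉ B ∧ φ.Realize M fun t c => r t (w t c) := by
  classical
  -- `mv z` sends the element `y` to `z` and fixes every other element, so all constants with value
  -- `y` move together.
  let mv : M.carrier s → ∀ t, M.carrier t → M.carrier t := fun z t m =>
    if h : (⟨t, m⟩ : Σ s, M.carrier s) = ⟨s, y⟩ then cast (congrArg M.carrier (congrArg Sigma.fst h).symm) z else m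
  have hmv : ∀ z t m, (⟨t, m⟩ : Σ s, M.carrier s) ≠ ⟨s, y⟩ → mv z t m = m :=
    fun z t m h => dif_neg h
  have hmv' : ∀ z, mv z s y = z := fun z => dif_pos rfl
  by_contra! hcon
  have hcon' : ∀ z, φ.Realize M (fun t c => mv z t (w t c)) →
      (⟨s, z⟩ : Σ s, M.carrier s) ∈ B := by
    intro z hz
    by_contra hzB
    exact hcon (mv z) (hmv z) (by rwa [hmv']) hz
  -- Every element of the structure except `y` becomes a parameter. A unique solution `y` could then
  -- not be named by a parameter.
  let V' : S → Type u := fun t => {m : M.carrier t // (⟨t, m⟩ : Σ s, M.carrier s) ≠ ⟨s, y⟩}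
  let v' : M.Val V' := fun t m => m.1
  let σ : ∀ t, V t → Term F (AddVar V' s) t := fun t c =>
    if h : (⟨t, w t c⟩ : Σ s, M.carrier s) = ⟨s, y⟩ then .var (.inr ⟨⟨congrArg Sigma.fst h⟩⟩)
    else .var (.inl ⟨w t c, h⟩)
  have hσ : ∀ z, (fun t c => (σ t c).eval M (v'.add z)) = fun t c => mv z t (w t c) := by
    intro z
    funext t c
    by_cases h : (⟨t, w t c⟩ : Σ s, M.carrier s) = ⟨s, y⟩
    · simp only [σ, mv, dif_pos h]
      have : ∀ m (h : (⟨t, m⟩ : Σ s, M.carrier s) = ⟨s, y⟩),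
          Term.eval (F := F) M (v'.add z) (.var (.inr ⟨⟨congrArg Sigma.fst h⟩⟩)) =
            cast (congrArg M.carrier (congrArg Sigma.fst h).symm) z := by
        intro m h
        cases h
        rfl
      exact this _ h
    · simp only [σ, mv, dif_neg h]
      rfl
  have hB' : {m : V' s | (⟨s, m.1⟩ : Σ s, M.carrier s) ∈ B}.Finite := by
    refine hB.preimage (f := fun m : V' s => (⟨s, m.1⟩ : Σ s, M.carrier s)) ?_
    rintro ⟨m, hm⟩ - ⟨m', hm'⟩ - h
    cases h
    rfl
  obtain ⟨δ, -, hδ⟩ := exists_conj (hB'.image fun m : V' s =>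
    (QF.neg (.atom (.eq (.var (.inr ⟨⟨rfl⟩⟩)) (.var (.inl m)))) : QF F P (AddVar V' s)))
  have hreal : ∀ z, QF.Realize M (v'.add z) (.conj (φ.subst σ) δ) ↔
      φ.Realize M (fun t c => mv z t (w t c)) ∧
        ∀ m : V' s, (⟨s, m.1⟩ : Σ s, M.carrier s) ∈ B → z ≠ m.1 := by
    intro z
    refine and_congr ?_ ?_
    · rw [QF.realize_subst, hσ]
    · rw [hδ, Set.forall_mem_image]
      rfl
  have hsol : QF.Realize M (v'.add y) (.conj (φ.subst σ) δ) := by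
    rw [hreal]
    refine ⟨?_, fun m _ h => m.2 (congrArg (Sigma.mk s) h.symm)⟩
    convert hw using 3 with t c
    by_cases h : (⟨t, w t c⟩ : Σ s, M.carrier s) = ⟨s, y⟩
    · have : ∀ m, (⟨t, m⟩ : Σ s, M.carrier s) = ⟨s, y⟩ → mv y t m = m := by
        intro m hm
        cases hm
        exact hmv' y
      exact this _ h
    · exact hmv _ _ _ h
  -- If no solution escapes `B`, then excluding by `δ` the points of `B` other than `y` leaves `y`
  -- as the only solution. It would equal a parameter, although `y` is not one.
  obtain ⟨x, hx⟩ := exists_eq_of_unique hqe heq hs (.conj (φ.subst σ) δ) hM v' y hsol (by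
    intro z hz
    rw [hreal] at hz
    by_contra hzy
    have hne : (⟨s, z⟩ : Σ s, M.carrier s) ≠ ⟨s, y⟩ := by
      intro h
      cases h
      exact hzy rfl
    exact hz.2 ⟨z, hne⟩ (hcon' z hz.1) rfl)
  exact x.2 (congrArg (Sigma.mk s) hx)

/-- The points of `L` are vacated one after the other. Each moved value must avoid the points
treated earlier as well as its own former place, so no later move refills a vacated point. -/
theorem exists_move_values {T : Set (Sentence F P)} (hqe : HasQE T) (heq : IsEqInterpolating T)
    (φ : QF F P V) {M : Struct F P} (hM : M ∈ models T) (w : M.Val V) (hw : φ.Realize M w)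
    {L : Set (Σ s, M.carrier s)} (hL : L.Finite) (hLs : ∀ p ∈ L, ∀ f : F.Sym, F.cod f ≠ p.1) :
    ∃ r : ∀ t, M.carrier t → M.carrier t,
      (∀ t m, (⟨t, m⟩ : Σ s, M.carrier s) ∉ L → r t m = m) ∧
      (∀ t m, (⟨t, r t m⟩ : Σ s, M.carrier s) ∉ L) ∧ φ.Realize M fun t c => r t (w t c) := by
  induction L, hL using Set.Finite.induction_on with
  | empty => exact ⟨fun _ m => m, by simp, by simp, hw⟩
  | @insert p L _ hL ih =>
    obtain ⟨r, h1, h2, h3⟩ := ih fun q hq => hLs q (Or.inr hq)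
    obtain ⟨s, y⟩ := p
    obtain ⟨r', k1, k2, k3⟩ := exists_move_value hqe heq (hLs _ (Or.inl rfl)) φ hM _ h3 y
      (hL.insert ⟨s, y⟩)
    refine ⟨fun t m => r' t (r t m), fun t m hm => ?_, fun t m => ?_, k3⟩
    · change r' t (r t m) = m
      rw [h1 t m fun h => hm (Or.inr h), k1]
      exact fun h => hm (Or.inl h)
    · by_cases h : (⟨t, r t m⟩ : Σ s, M.carrier s) = ⟨s, y⟩
      · have : ∀ m, (⟨t, m⟩ : Σ s, M.carrier s) = ⟨s, y⟩ →
            (⟨t, r' t m⟩ : Σ s, M.carrier s) ∉ insert ⟨s, y⟩ L := by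
          intro m hm
          cases hm
          exact k2
        exact this _ h
      · change (⟨t, r' t (r t m)⟩ : Σ s, M.carrier s) ∉ _
        rw [k1 _ _ h]
        rintro (h' | h')
        · exact h h'
        · exact h2 t m h'

/-! ### Inversion of terms -/

/-- The root of a term, together with the arguments. -/
def Term.dest : ∀ {s : S}, Term F V s → (Σ s, V s) ⊕ Σ f : F.Sym, ∀ i, Term F V (F.dom f i)
  | _, .var x => .inl ⟨_, x⟩
  | _, .app f args => .inr ⟨f, args⟩

/-- Terms whose sorts need not be visibly equal are compared through `dest`, whose type does not
mention the sort. -/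
theorem Term.var_ne_app {s : S} {x : V s} {f : F.Sym} {a : ∀ i, Term F V (F.dom f i)} :
    (⟨s, .var x⟩ : Σ s, Term F V s) ≠ ⟨_, .app f a⟩ := by
  intro h
  have : (Sum.inl _ : (Σ s, V s) ⊕ Σ f : F.Sym, ∀ i, Term F V (F.dom f i)) = Sum.inr _ :=
    congrArg (fun p : Σ s, Term F V s => p.2.dest) h
  cases this

theorem Term.app_inj {f g : F.Sym} {a : ∀ i, Term F V (F.dom f i)}
    {b : ∀ i, Term F V (F.dom g i)}
    (h : (⟨_, .app f a⟩ : Σ s, Term F V s) = ⟨_, .app g b⟩) :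
    (⟨f, a⟩ : Σ f : F.Sym, ∀ i, Term F V (F.dom f i)) = ⟨g, b⟩ :=
  Sum.inr.inj (congrArg (fun p : Σ s, Term F V s => p.2.dest) h)

theorem Term.extApp_inj {f g : E.Sym}
    {a : ∀ i, Term (F.sum E) V ((F.sum E).dom (Sum.inr f) i)}
    {b : ∀ i, Term (F.sum E) V ((F.sum E).dom (Sum.inr g) i)}
    (h : (⟨_, .app (Sum.inr f) a⟩ : Σ s, Term (F.sum E) V s) = ⟨_, .app (Sum.inr g) b⟩) :
    (⟨f, a⟩ : Σ f : E.Sym, ∀ i, Term (F.sum E) V ((F.sum E).dom (Sum.inr f) i)) = ⟨g, b⟩ := by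
  obtain ⟨h1, h2⟩ := Sigma.mk.inj_iff.1 (Term.app_inj h)
  cases Sum.inr.inj h1
  cases h2
  rfl

theorem Term.baseApp_ne_extApp {f : F.Sym} {g : E.Sym}
    {a : ∀ i, Term (F.sum E) V ((F.sum E).dom (Sum.inl f) i)}
    {b : ∀ i, Term (F.sum E) V ((F.sum E).dom (Sum.inr g) i)} :
    (⟨_, .app (Sum.inl f) a⟩ : Σ s, Term (F.sum E) V s) ≠ ⟨_, .app (Sum.inr g) b⟩ := by
  intro h
  have h1 := (Sigma.mk.inj_iff.1 (Term.app_inj h)).1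
  cases h1

/-! ### Purification -/

def QF.purify : QF (F.sum E) P C → QF F P (PureConst F E C)
  | .falsum => .falsum
  | .atom a => .atom a.purify
  | .neg φ => .neg φ.purify
  | .conj φ ψ => .conj φ.purify ψ.purify
  | .disj φ ψ => .disj φ.purify ψ.purify

theorem Clause.toQF_purify (D : Clause (F.sum E) P C) :
    Clause.toQF (Clause.purify D) = (Clause.toQF D).purify := by
  induction D with
  | nil => rfl
  | cons l D ih =>
    have : Clause.toQF (Clause.purify (l :: D)) =
      .disj l.purify.toQF (Clause.toQF (Clause.purify D)) := rfl
    rw [this, ih]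
    cases l <;> rfl

/-- The constant `c_t` for the extension term `t = f(args)`. -/
abbrev PureConst.ofApp (f : E.Sym) (args : ∀ i, Term (F.sum E) C ((F.sum E).dom (Sum.inr f) i)) :
    PureConst F E C ((F.sum E).cod (Sum.inr f)) :=
  Sum.inr ⟨.app (F := F.sum E) (Sum.inr f) args, trivial⟩

/-- The interpretation `v` of the constants and the valuation `w` of the purified constants
agree on the terms in `U`. -/
def Agrees (M : Struct (F.sum E) P) (v : M.Val C) (w : M.reduct.Val (PureConst F E C))
    (U : Set (Σ s, Term (F.sum E) C s)) : Prop :=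
  (∀ s (c : C s), (⟨s, .var c⟩ : Σ s, Term (F.sum E) C s) ∈ U → v s c = w s (Sum.inl c)) ∧
  ∀ (f : E.Sym) (args : ∀ i, Term (F.sum E) C ((F.sum E).dom (Sum.inr f) i)),
    (⟨_, .app (Sum.inr f) args⟩ : Σ s, Term (F.sum E) C s) ∈ U →
    M.fn (Sum.inr f) (fun i => (args i).purify.eval M.reduct w) = w _ (.ofApp f args)

theorem Agrees.mono {M : Struct (F.sum E) P} {v : M.Val C} {w : M.reduct.Val (PureConst F E C)}
    {U U' : Set (Σ s, Term (F.sum E) C s)} (h : Agrees M v w U) (hU : U' ⊆ U) :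
    Agrees M v w U' :=
  ⟨fun s c hc => h.1 s c (hU hc), fun f args ha => h.2 f args (hU ha)⟩

/-- `Agrees` evaluates arguments in their purified form. The induction hypothesis on the arguments
therefore fits its clause for extension terms exactly. -/
theorem Agrees.eval_eq {M : Struct (F.sum E) P} {v : M.Val C}
    {w : M.reduct.Val (PureConst F E C)} {s : S} (t : Term (F.sum E) C s)
    (h : Agrees M v w t.subterms) : t.eval M v = t.purify.eval M.reduct w := by
  induction t with
  | var c => exact h.1 _ c rfl
  | app f args ih =>
    have ih' := fun i => ih i (h.mono (Term.arg_subterms_subset f args i))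
    rcases f with f | f
    · exact congrArg (M.fn (Sum.inl f)) (funext ih')
    · exact (congrArg (M.fn (Sum.inr f)) (funext ih')).trans (h.2 f args (Or.inl rfl))

theorem Agrees.realize_iff {M : Struct (F.sum E) P} {v : M.Val C}
    {w : M.reduct.Val (PureConst F E C)} (φ : QF (F.sum E) P C)
    (h : Agrees M v w φ.subterms) : φ.Realize M v ↔ φ.purify.Realize M.reduct w := by
  induction φ with
  | falsum => rfl
  | atom a =>
    cases a with
    | eq t t' =>
      have h1 := Agrees.eval_eq t (h.mono Set.subset_union_left)
      have h2 := Agrees.eval_eq t' (h.mono Set.subset_union_right)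
      change t.eval M v = t'.eval M v ↔ t.purify.eval M.reduct w = t'.purify.eval M.reduct w
      rw [h1, h2]
      rfl
    | rel r args =>
      have h1 : ∀ i, _ = _ := fun i => Agrees.eval_eq (args i)
        (h.mono (Set.subset_iUnion (fun i => (args i).subterms) i))
      exact iff_of_eq (congrArg (M.rel r) (funext h1))
  | neg φ ih => exact not_congr (ih h)
  | conj φ ψ ih ih' =>
    exact and_congr (ih (h.mono Set.subset_union_left)) (ih' (h.mono Set.subset_union_right))
  | disj φ ψ ih ih' =>
    exact or_congr (ih (h.mono Set.subset_union_left)) (ih' (h.mono Set.subset_union_right))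

/-- The valuation which interprets the constants `c_t` by the values of the terms `t`. -/
def Struct.pureVal (M : Struct (F.sum E) P) (v : M.Val C) : M.reduct.Val (PureConst F E C) :=
  fun _ c => c.back.eval M v

theorem agrees_pureVal (M : Struct (F.sum E) P) (v : M.Val C)
    (U : Set (Σ s, Term (F.sum E) C s)) : Agrees M v (M.pureVal v) U := by
  have key : ∀ {s : S} (t : Term (F.sum E) C s),
      t.purify.eval M.reduct (M.pureVal v) = t.eval M v := by
    intro s t
    induction t with
    | var c => rfl
    | app f args ih =>
      rcases f with f | f
      · exact congrArg (M.fn (Sum.inl f)) (funext ih)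
      · rfl
  exact ⟨fun s c _ => rfl, fun f args _ =>
    congrArg (M.fn (Sum.inr f)) (funext fun i => key (args i))⟩

/-- The congruence axioms for the terms in `Def`. -/
def IsCongruent (B : Struct F P) (w : B.Val (PureConst F E C))
    (Def : Set (Σ s, Term (F.sum E) C s)) : Prop :=
  ∀ (f : E.Sym) (a b : ∀ i, Term (F.sum E) C ((F.sum E).dom (Sum.inr f) i)),
    (⟨_, .app (Sum.inr f) a⟩ : Σ s, Term (F.sum E) C s) ∈ Def →
    (⟨_, .app (Sum.inr f) b⟩ : Σ s, Term (F.sum E) C s) ∈ Def →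
    (∀ i, (a i).purify.eval B w = (b i).purify.eval B w) →
    w _ (.ofApp f a) = w _ (.ofApp f b)

theorem realize_conClauses (B : Struct F P) (w : B.Val (PureConst F E C))
    (Def : Set (Σ s, Term (F.sum E) C s)) :
    (∀ D ∈ conClauses P Def, Clause.Realize B w D) ↔ IsCongruent B w Def := by
  have key : ∀ (f : E.Sym) (a b : ∀ i, Term (F.sum E) C ((F.sum E).dom (Sum.inr f) i)),
      Clause.Realize B w ((List.ofFn fun i => Literal.neg (.eq (a i).purify (b i).purify)) ++
        [Literal.pos (.eq (Term.purify (.app (F := F.sum E) (Sum.inr f) a))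
          (Term.purify (.app (F := F.sum E) (Sum.inr f) b)))]) ↔
      ((∀ i, (a i).purify.eval B w = (b i).purify.eval B w) →
        w _ (.ofApp f a) = w _ (.ofApp f b)) := by
    intro f a b
    simp only [Clause.Realize, List.mem_append, List.mem_ofFn, List.mem_singleton, or_and_right,
      exists_or, exists_exists_eq_and, exists_eq_left]
    rw [← not_imp_not (b := ∀ i, _), or_iff_not_imp_right, not_forall]
    rfl
  constructor
  · intro h f a b ha hb
    exact (key f a b).1 (h _ ⟨f, a, b, ha, hb, rfl⟩)
  · rintro h _ ⟨f, a, b, ha, hb, rfl⟩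
    exact (key f a b).2 (h f a b ha hb)

theorem finite_conClauses {Def : Set (Σ s, Term (F.sum E) C s)} (h : Def.Finite) :
    (conClauses P Def).Finite := by
  let Y := Σ f : E.Sym, (∀ i, Term (F.sum E) C ((F.sum E).dom (Sum.inr f) i)) ×
    ∀ i, Term (F.sum E) C ((F.sum E).dom (Sum.inr f) i)
  let i : Y → (Σ s, Term (F.sum E) C s) × Σ s, Term (F.sum E) C s := fun y =>
    (⟨_, .app (Sum.inr y.1) y.2.1⟩, ⟨_, .app (Sum.inr y.1) y.2.2⟩)
  have hi : Function.Injective i := by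
    rintro ⟨f, a, b⟩ ⟨f', a', b'⟩ h
    have h1 := Term.extApp_inj (congrArg Prod.fst h)
    have h2 := Term.extApp_inj (congrArg Prod.snd h)
    cases h1
    cases h2
    rfl
  refine (((h.prod h).preimage hi.injOn).image fun y : Y =>
    ((List.ofFn fun i => Literal.neg (.eq (y.2.1 i).purify (y.2.2 i).purify)) ++
      [Literal.pos (.eq (Term.purify (.app (F := F.sum E) (Sum.inr y.1) y.2.1))
        (Term.purify (.app (F := F.sum E) (Sum.inr y.1) y.2.2)))] :
      Clause F P (PureConst F E C))).subset ?_
  rintro _ ⟨f, a, b, ha, hb, rfl⟩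
  exact ⟨⟨f, a, b⟩, ⟨ha, hb⟩, rfl⟩

/-! ### Changing the interpretation of the extension symbols -/

/-- The expansion of a base structure by an interpretation of the extension symbols. -/
def Struct.withExt (B : Struct F P)
    (g : ∀ f : E.Sym, (∀ i, B.carrier (E.dom f i)) → B.carrier (E.cod f)) :
    Struct (F.sum E) P where
  carrier := B.carrier
  nonempty := B.nonempty
  fn := fun f => match f with
    | .inl f => B.fn f
    | .inr f => g f
  rel := B.rel

section withExt

variable (M : Struct (F.sum E) P)
  (g : ∀ f : E.Sym, (∀ i, M.carrier (E.dom f i)) → M.carrier (E.cod f))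

/-- A new interpretation of the extension symbols is invisible to a term as soon as it agrees with
the old one at the argument tuples that the term actually reaches. -/
theorem eval_withExt (v v' : M.Val V) {s : S} (t : Term (F.sum E) V s)
    (hv : ∀ s (c : V s), (⟨s, .var c⟩ : Σ s, Term (F.sum E) V s) ∈ t.subterms → v' s c = v s c)
    (hg : ∀ (f : E.Sym) (args : ∀ i, Term (F.sum E) V ((F.sum E).dom (Sum.inr f) i)),
      (⟨_, .app (Sum.inr f) args⟩ : Σ s, Term (F.sum E) V s) ∈ t.subterms →
      g f (fun i => (args i).eval M v) = M.fn (Sum.inr f) fun i => (args i).eval M v) :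
    t.eval (M.reduct.withExt g) v' = t.eval M v := by
  induction t with
  | var c => exact hv _ c rfl
  | app f args ih =>
    have ih' := fun i => ih i
      (fun s c hc => hv s c (Term.arg_subterms_subset f args i hc))
      (fun f' a ha => hg f' a (Term.arg_subterms_subset f args i ha))
    rcases f with f | f
    · exact congrArg (M.fn (Sum.inl f)) (funext ih')
    · exact (congrArg (g f) (funext ih')).trans (hg f args (Or.inl rfl))

theorem realize_withExt (v v' : M.Val V) (φ : QF (F.sum E) P V)
    (hv : ∀ s (c : V s), (⟨s, .var c⟩ : Σ s, Term (F.sum E) V s) ∈ φ.subterms → v' s c = v s c)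
    (hg : ∀ (f : E.Sym) (args : ∀ i, Term (F.sum E) V ((F.sum E).dom (Sum.inr f) i)),
      (⟨_, .app (Sum.inr f) args⟩ : Σ s, Term (F.sum E) V s) ∈ φ.subterms →
      g f (fun i => (args i).eval M v) = M.fn (Sum.inr f) fun i => (args i).eval M v) :
    φ.Realize (M.reduct.withExt g) v' ↔ φ.Realize M v := by
  induction φ with
  | falsum => rfl
  | atom a =>
    cases a with
    | eq t t' =>
      have h1 := eval_withExt M g v v' t (fun s c hc => hv s c (Or.inl hc))
        (fun f a ha => hg f a (Or.inl ha))
      have h2 := eval_withExt M g v v' t' (fun s c hc => hv s c (Or.inr hc))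
        (fun f a ha => hg f a (Or.inr ha))
      change t.eval (M.reduct.withExt g) v' = t'.eval (M.reduct.withExt g) v' ↔
        t.eval M v = t'.eval M v
      rw [h1, h2]
      rfl
    | rel r args =>
      exact iff_of_eq (congrArg (M.rel r) (funext fun i => eval_withExt M g v v' (args i)
        (fun s c hc => hv s c (Set.mem_iUnion.2 ⟨i, hc⟩))
        (fun f a ha => hg f a (Set.mem_iUnion.2 ⟨i, ha⟩))))
  | neg φ ih => exact not_congr (ih hv hg)
  | conj φ ψ ih ih' =>
    exact and_congr
      (ih (fun s c hc => hv s c (Or.inl hc)) (fun f a ha => hg f a (Or.inl ha)))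
      (ih' (fun s c hc => hv s c (Or.inr hc)) (fun f a ha => hg f a (Or.inr ha)))
  | disj φ ψ ih ih' =>
    exact or_congr
      (ih (fun s c hc => hv s c (Or.inl hc)) (fun f a ha => hg f a (Or.inl ha)))
      (ih' (fun s c hc => hv s c (Or.inr hc)) (fun f a ha => hg f a (Or.inr ha)))

end withExt

open Classical in
/-- The interpretation of the extension symbols in which the symbols in `Q` have the values at the
terms in `Def` prescribed by `w`, and which is unchanged otherwise. -/
noncomputable def Struct.redefineFn (M : Struct (F.sum E) P)
    (w : M.reduct.Val (PureConst F E C)) (Def : Set (Σ s, Term (F.sum E) C s)) (Q : Set E.Sym)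
    (f : E.Sym) (m : ∀ i, M.carrier (E.dom f i)) : M.carrier (E.cod f) :=
  if h : f ∈ Q ∧ ∃ args : ∀ i, Term (F.sum E) C ((F.sum E).dom (Sum.inr f) i),
      (⟨_, .app (Sum.inr f) args⟩ : Σ s, Term (F.sum E) C s) ∈ Def ∧
      ∀ i, (args i).purify.eval M.reduct w = m i
  then w _ (.ofApp f h.2.choose) else M.fn (Sum.inr f) m

section redefine

variable {M : Struct (F.sum E) P} {w : M.reduct.Val (PureConst F E C)}
  {Def : Set (Σ s, Term (F.sum E) C s)} {Q : Set E.Sym} {f : E.Sym}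

/-- The definition picks some term of `Def` with the given argument values, not necessarily
`f(args)`. Congruence makes the choice irrelevant. -/
theorem redefineFn_of_mem (hcon : IsCongruent M.reduct w Def) (hf : f ∈ Q)
    {args : ∀ i, Term (F.sum E) C ((F.sum E).dom (Sum.inr f) i)}
    (ha : (⟨_, .app (Sum.inr f) args⟩ : Σ s, Term (F.sum E) C s) ∈ Def)
    {m : ∀ i, M.carrier (E.dom f i)} (hm : ∀ i, (args i).purify.eval M.reduct w = m i) :
    M.redefineFn w Def Q f m = w _ (.ofApp f args) := by
  have h : f ∈ Q ∧ ∃ args : ∀ i, Term (F.sum E) C ((F.sum E).dom (Sum.inr f) i),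
      (⟨_, .app (Sum.inr f) args⟩ : Σ s, Term (F.sum E) C s) ∈ Def ∧
      ∀ i, (args i).purify.eval M.reduct w = m i := ⟨hf, args, ha, hm⟩
  exact (dif_pos h).trans
    (hcon f _ _ h.2.choose_spec.1 ha fun i => (h.2.choose_spec.2 i).trans (hm i).symm)

theorem redefineFn_of_not {m : ∀ i, M.carrier (E.dom f i)}
    (h : ∀ args : ∀ i, Term (F.sum E) C ((F.sum E).dom (Sum.inr f) i), f ∈ Q →
      (⟨_, .app (Sum.inr f) args⟩ : Σ s, Term (F.sum E) C s) ∈ Def →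
      ¬ ∀ i, (args i).purify.eval M.reduct w = m i) :
    M.redefineFn w Def Q f m = M.fn (Sum.inr f) m :=
  dif_neg fun ⟨hf, args, ha, hm⟩ => h args hf ha hm

end redefine

/-! ### Extension terms and instances -/

theorem Term.isExt_iff {p : Σ s, Term (F.sum E) V s} : p.2.IsExt ↔
    ∃ (f : E.Sym) (args : ∀ i, Term (F.sum E) V ((F.sum E).dom (Sum.inr f) i)),
      p = ⟨_, .app (Sum.inr f) args⟩ := by
  constructor
  · intro h
    obtain ⟨s, t⟩ := p
    cases t with
    | var x => exact h.elim
    | app f args =>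
      rcases f with f | f
      · exact h.elim
      · exact ⟨f, args, rfl⟩
  · rintro ⟨f, args, rfl⟩
    exact trivial

theorem extTerms_union (Φ Ψ : Set (QF (F.sum E) P V)) :
    extTerms (Φ ∪ Ψ) = extTerms Φ ∪ extTerms Ψ := by
  ext p
  simp only [extTerms, subterms_union, Set.mem_ofPred_eq, Set.mem_union, or_and_right]

theorem finite_extTerms {Φ : Set (QF (F.sum E) P V)} (h : Φ.Finite) : (extTerms Φ).Finite :=
  (finite_subterms h).subset fun _ hp => hp.1

theorem Term.subst_congr {σ τ : ∀ s, V s → Term F W s} {s : S} (t : Term F V s)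
    (h : ∀ c ∈ varsIn t.subterms, σ c.1 c.2 = τ c.1 c.2) : t.subst σ = t.subst τ := by
  induction t with
  | var x => exact h ⟨_, x⟩ rfl
  | app f args ih =>
    exact congrArg (Term.app f) (funext fun i => ih i fun c hc =>
      h c (Term.arg_subterms_subset f args i hc))

theorem Term.eq_of_subst_eq {σ τ : ∀ s, V s → Term F W s} {s : S} (t : Term F V s)
    (h : t.subst σ = t.subst τ) : ∀ c ∈ varsIn t.subterms, σ c.1 c.2 = τ c.1 c.2 := by
  induction t with
  | var x =>
    intro c hc
    cases hc
    exact h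
  | app f args ih =>
    rintro c (hc | hc)
    · exact (Term.var_ne_app hc).elim
    · obtain ⟨i, hi⟩ := Set.mem_iUnion.1 hc
      have : (fun i => (args i).subst σ) = fun i => (args i).subst τ := by
        have h' : Term.app f (fun i => (args i).subst σ) =
          Term.app f (fun i => (args i).subst τ) := h
        injection h'
      exact ih i (congrFun this i) c hi

theorem Clause.subst_congr {σ τ : ∀ s, V s → Term F W s} (D : Clause F P V)
    (h : ∀ c ∈ consts {Clause.toQF D}, σ c.1 c.2 = τ c.1 c.2) :
    Clause.subst σ D = Clause.subst τ D := by
  have atom : ∀ a : Atom F P V, (∀ c ∈ varsIn a.subterms, σ c.1 c.2 = τ c.1 c.2) →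
      a.subst σ = a.subst τ := by
    intro a ha
    cases a with
    | eq t t' =>
      exact congrArg₂ Atom.eq (t.subst_congr fun c hc => ha c (Or.inl hc))
        (t'.subst_congr fun c hc => ha c (Or.inr hc))
    | rel r args =>
      exact congrArg (Atom.rel r) (funext fun i => (args i).subst_congr fun c hc =>
        ha c (Set.mem_iUnion.2 ⟨i, hc⟩))
  simp only [consts, subterms_singleton] at h
  induction D with
  | nil => rfl
  | cons l D ih =>
    refine congrArg₂ List.cons ?_ (ih fun c hc => h c (Or.inr hc))
    cases l with
    | pos a => exact congrArg Literal.pos (atom a fun c hc => h c (Or.inl hc))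
    | neg a => exact congrArg Literal.neg (atom a fun c hc => h c (Or.inl hc))

theorem subst_mem_extTerms {σ : ∀ s, X s → Term (F.sum E) C s} {D : Clause (F.sum E) P X}
    {p : Σ s, Term (F.sum E) X s} (hp : p ∈ extTerms {Clause.toQF D}) :
    (⟨p.1, p.2.subst σ⟩ : Σ s, Term (F.sum E) C s) ∈
      extTerms {Clause.toQF (Clause.subst σ D)} := by
  obtain ⟨h1, h2⟩ := hp
  obtain ⟨f, args, rfl⟩ := Term.isExt_iff.1 h2
  refine ⟨?_, trivial⟩
  rw [subterms_singleton] at h1 ⊢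
  rw [Clause.toQF_subst]
  exact QF.subst_mem_subterms σ _ h1

/-- Every variable lies below an extension term, so an instance is determined by where the finitely
many extension terms of its clause are sent, and their images are in the finite set `T`. -/
theorem finite_instances {K : Set (Clause (F.sum E) P X)} (hK : K.Finite)
    (hvars : ∀ D ∈ K, Clause.VarsBelowExt D) {T : Set (Σ s, Term (F.sum E) C s)}
    (hT : T.Finite) : (instances K T).Finite := by
  have key : ∀ D ∈ K, {D' : Clause (F.sum E) P C | ∃ σ : ∀ s, X s → Term (F.sum E) C s,
      D' = Clause.subst σ D ∧ extTerms {Clause.toQF D'} ⊆ T}.Finite := by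
    intro D hD
    let Z : Set (∀ s, X s → Term (F.sum E) C s) :=
      {σ | extTerms {Clause.toQF (Clause.subst σ D)} ⊆ T}
    let U := extTerms {Clause.toQF D}
    have hU : U.Finite := finite_extTerms (Set.finite_singleton _)
    have := hU.to_subtype
    let r : (∀ s, X s → Term (F.sum E) C s) → U → Σ s, Term (F.sum E) C s :=
      fun σ p => ⟨p.1.1, p.1.2.subst σ⟩
    have hr : (r '' Z).Finite := by
      refine (Set.Finite.pi' fun _ : U => hT).subset ?_
      rintro _ ⟨σ, hσ, rfl⟩ p
      exact hσ (subst_mem_extTerms p.2)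
    have hfac : Function.FactorsThrough (fun σ => Clause.subst σ D) r := by
      intro σ τ h
      refine Clause.subst_congr D fun c hc => ?_
      obtain ⟨p, hp, hcp⟩ := hvars D hD c hc
      exact p.2.eq_of_subst_eq (eq_of_heq (Sigma.mk.inj_iff.1 (congrFun h ⟨p, hp⟩)).2) c hcp
    refine (hr.image (Function.extend r (fun σ => Clause.subst σ D) fun _ => [])).subset ?_
    rintro _ ⟨σ, rfl, hσ⟩
    exact ⟨_, ⟨σ, hσ, rfl⟩, hfac.extend_apply _ σ⟩
  refine (hK.biUnion key).subset ?_
  rintro D' ⟨D, hD, σ, h⟩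
  exact Set.mem_biUnion hD ⟨σ, h⟩

theorem finite_est {K : Set (Clause (F.sum E) P X)} (hK : K.Finite)
    {G : Set (Clause (F.sum E) P C)} (hG : G.Finite) : (est K G).Finite := by
  refine (finite_extTerms (hG.image _)).union ?_
  let i : (Σ s, Term (F.sum E) (fun _ => PEmpty.{u + 1}) s) → Σ s, Term (F.sum E) X s :=
    fun p => ⟨p.1, p.2.subst fun _ x => x.elim⟩
  have hi : Function.Injective i := by
    rintro ⟨s, t⟩
    induction t with
    | var x => exact x.elim
    | app f args ih =>
      rintro ⟨s', t'⟩ h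
      cases t' with
      | var x => exact x.elim
      | app f' args' =>
        have h' := Term.app_inj (f := f) (g := f') h
        obtain ⟨rfl, h'⟩ := Sigma.mk.inj_iff.1 h'
        refine congrArg (fun a => (⟨_, Term.app f a⟩ : Σ s, Term (F.sum E) _ s)) (funext fun k => ?_)
        have h2 := ih k (a₂ := ⟨_, args' k⟩)
          (congrArg (Sigma.mk _) (congrFun (eq_of_heq h') k))
        exact eq_of_heq (Sigma.mk.inj_iff.1 h2).2
  refine (((finite_extTerms (hK.image Clause.toQF)).preimage hi.injOn).image
    fun p : (Σ s, Term (F.sum E) (fun _ => PEmpty.{u + 1}) s) =>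
      (⟨p.1, p.2.subst fun _ x => x.elim⟩ : Σ s, Term (F.sum E) C s)).subset ?_
  rintro p ⟨s, t, ht, rfl⟩
  exact ⟨⟨s, t⟩, ht, rfl⟩

theorem PureConst.isExt_back_or {s : S} (c : PureConst F E C s) :
    c.back.IsExt ∨ ∃ x, c.back = .var x := by
  rcases c with c | t
  · exact Or.inr ⟨c, rfl⟩
  · exact Or.inl t.2

/-! ### Shared constants and shared terms -/

theorem IsSharedConst.subterms_eq {Ss' : Set E.Sym} {s : S} {t : Term (F.sum E) C s}
    (h : IsSharedConst Ss' t) : t.subterms = {⟨s, t⟩} := by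
  rcases h with ⟨c, rfl⟩ | ⟨f, -, hf, args, h⟩
  · rfl
  · have : ∀ {p q : Σ s, Term (F.sum E) C s}, p = q → q.2.subterms = {q} →
        p.2.subterms = {p} := by
      rintro p q rfl h
      exact h
    refine this h (Set.ext fun q => ?_)
    refine or_iff_left ?_
    rw [Set.mem_iUnion]
    rintro ⟨i, -⟩
    exact (Fin.cast hf i).elim0

theorem IsSharedConst.exists_purify {Ss' : Set E.Sym} {s : S} {t : Term (F.sum E) C s}
    (h : IsSharedConst Ss' t) : ∃ c : PureConst F E C s, t.purify = .var c ∧ c.back = t := by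
  rcases h with ⟨c, rfl⟩ | ⟨f, -, hf, args, h⟩
  · exact ⟨Sum.inl c, rfl, rfl⟩
  · have : ∀ {p q : Σ s, Term (F.sum E) C s}, p = q →
        (∃ c : PureConst F E C q.1, q.2.purify = .var c ∧ c.back = q.2) →
        ∃ c : PureConst F E C p.1, p.2.purify = .var c ∧ c.back = p.2 := by
      rintro p q rfl h
      exact h
    exact this h ⟨.ofApp f args, rfl, rfl⟩

theorem IsSharedConst.mem_sharedTerms {Ss' : Set E.Sym} {s : S} {t : Term (F.sum E) C s}
    (h : IsSharedConst Ss' t) (ht : t.IsExt) :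
    (⟨s, t⟩ : Σ s, Term (F.sum E) C s) ∈ sharedTerms F C Ss' := by
  rcases h with ⟨c, rfl⟩ | ⟨f, hf, hf', args, h⟩
  · exact ht.elim
  · exact ⟨f, hf, args, fun i => (Fin.cast hf' i).elim0, h⟩

theorem extSym_mem_of_sharedTerms {Ss' : Set E.Sym} {p : Σ s, Term (F.sum E) C s}
    (hp : p ∈ sharedTerms F C Ss') {g : E.Sym}
    {b : ∀ i, Term (F.sum E) C ((F.sum E).dom (Sum.inr g) i)}
    (hg : (⟨_, .app (Sum.inr g) b⟩ : Σ s, Term (F.sum E) C s) ∈ p.2.subterms) : g ∈ Ss' := by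
  obtain ⟨f, hf, args, ha, rfl⟩ := hp
  rcases hg with hg | hg
  · cases Term.extApp_inj hg
    exact hf
  · obtain ⟨i, hi⟩ := Set.mem_iUnion.1 hg
    rw [(ha i).subterms_eq] at hi
    rcases ha i with ⟨c, h⟩ | ⟨e, he, -, a, h⟩
    · rw [h] at hi
      exact (Term.var_ne_app (Eq.symm hi)).elim
    · cases Term.extApp_inj (Eq.trans hi h)
      exact he

theorem isCongruent_pureVal (M : Struct (F.sum E) P) (v : M.Val C)
    (Def : Set (Σ s, Term (F.sum E) C s)) : IsCongruent M.reduct (M.pureVal v) Def := by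
  intro f a b _ _ h
  refine congrArg (M.fn (Sum.inr f)) (funext fun i => ?_)
  have key := fun t : Term (F.sum E) C ((F.sum E).dom (Sum.inr f) i) =>
    Agrees.eval_eq t (agrees_pureVal M v _)
  rw [key, key]
  exact h i

section SortConditions

variable {Ks K1 : Set (Clause (F.sum E) P X)} {Ss' : Set E.Sym} {S1 : Set S}

theorem SortConditions.cod_ne (hA : SortConditions Ks K1 Ss' S1) {s : S} (hs : s ∈ S1)
    (f : F.Sym) : F.cod f ≠ s := by
  rintro rfl
  rcases Nat.eq_zero_or_pos (F.arity f) with h | h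
  · exact hA.base_const f h hs
  · exact hA.output (Sum.inl f) h hs

/-- Functions of positive arity have values outside `S1`, no base constant has a sort in `S1`, and
extension constants of these sorts belong to `Ss'`. Only shared constants remain. -/
theorem SortConditions.isSharedConst (hA : SortConditions Ks K1 Ss' S1) {s : S} (hs : s ∈ S1)
    (t : Term (F.sum E) C s) : IsSharedConst Ss' t := by
  cases t with
  | var c => exact Or.inl ⟨c, rfl⟩
  | app f args =>
    rcases f with f | f
    · exact (hA.cod_ne hs f rfl).elim
    · rcases Nat.eq_zero_or_pos (E.arity f) with h | h
      · exact Or.inr ⟨f, hA.ext_const f h hs, h, args, rfl⟩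
      · exact (hA.output (Sum.inr f) h hs).elim

/-- Arguments of symbols in `Ss'` have sorts in `S1`, and terms of these sorts are the finitely many
constants of `C` there or nullary symbols of the finite signature `E`. -/
theorem SortConditions.finite_sharedTerms (hA : SortConditions Ks K1 Ss' S1)
    (hC : {c : Σ s, C s | c.1 ∈ S1}.Finite) : (sharedTerms F C Ss').Finite := by
  have := hA.finite_ext
  have hconst : {p : Σ s, Term (F.sum E) C s | p.1 ∈ S1}.Finite := by
    refine ((hC.image fun c : Σ s, C s => (⟨c.1, .var c.2⟩ : Σ s, Term (F.sum E) C s)).union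
      (Set.finite_iUnion fun f : E.Sym => Set.toFinite (Set.range
        fun h : PLift (E.arity f = 0) => (⟨_, .app (F := F.sum E) (Sum.inr f)
          fun i : Fin (E.arity f) => (Fin.cast h.down i).elim0⟩ : Σ s, Term (F.sum E) C s)))).subset ?_
    rintro ⟨s, t⟩ (hs : s ∈ S1)
    rcases hA.isSharedConst hs t with ⟨c, rfl⟩ | ⟨f, -, hf, args, h⟩
    · exact Or.inl ⟨⟨s, c⟩, hs, rfl⟩
    · refine Or.inr (Set.mem_iUnion.2 ⟨f, ⟨hf⟩, ?_⟩)
      rw [h]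
      refine congrArg (fun a => (⟨_, .app (Sum.inr f) a⟩ : Σ s, Term (F.sum E) C s))
        (funext fun i => (Fin.cast hf i).elim0)
  have hsort : ∀ s ∈ S1, (Set.univ : Set (Term (F.sum E) C s)).Finite := fun s hs =>
    (hconst.preimage (sigma_mk_injective (i := s)).injOn).subset fun t _ => hs
  have key : ∀ f : E.Sym, {p : Σ s, Term (F.sum E) C s | f ∈ Ss' ∧
      ∃ args : ∀ i, Term (F.sum E) C ((F.sum E).dom (Sum.inr f) i),
        p = ⟨_, .app (Sum.inr f) args⟩}.Finite := by
    intro f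
    by_cases hf : f ∈ Ss'
    · refine ((Set.Finite.pi' fun i => hsort _ (hA.input f hf i)).image
        fun args : (∀ i, Term (F.sum E) C ((F.sum E).dom (Sum.inr f) i)) =>
          (⟨_, .app (Sum.inr f) args⟩ : Σ s, Term (F.sum E) C s)).subset ?_
      rintro _ ⟨-, args, rfl⟩
      exact ⟨args, fun i => Set.mem_univ _, rfl⟩
    · exact Set.finite_empty.subset fun p hp => hf hp.1
  refine (Set.finite_iUnion key).subset ?_
  rintro _ ⟨f, hf, args, -, rfl⟩
  exact Set.mem_iUnion.2 ⟨f, hf, args, rfl⟩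

/-- A variable below an extension symbol of a flat clause is an immediate argument of it, because
the arguments are themselves variables. -/
theorem exists_arg_eq_var {D : Clause (F.sum E) P X} (hflat : Clause.IsFlat D)
    (hvars : Clause.VarsBelowExt D) {s : S} {x : X s}
    (hx : (⟨s, .var x⟩ : Σ s, Term (F.sum E) X s) ∈ (Clause.toQF D).subterms) :
    ∃ (f : E.Sym) (args : ∀ i, Term (F.sum E) X ((F.sum E).dom (Sum.inr f) i)),
      (⟨_, .app (Sum.inr f) args⟩ : Σ s, Term (F.sum E) X s) ∈ (Clause.toQF D).subterms ∧
      ∃ i, (⟨_, args i⟩ : Σ s, Term (F.sum E) X s) = ⟨s, .var x⟩ := by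
  obtain ⟨p, ⟨hp, hp'⟩, hxp⟩ := hvars ⟨s, x⟩ (by simpa [consts, varsIn] using hx)
  obtain ⟨f, args, rfl⟩ := Term.isExt_iff.1 hp'
  have hargs := hflat f args hp
  rw [subterms_singleton] at hp
  refine ⟨f, args, hp, ?_⟩
  rcases hxp with hxp | hxp
  · exact (Term.var_ne_app hxp).elim
  · obtain ⟨i, hi⟩ := Set.mem_iUnion.1 hxp
    obtain ⟨y, hy⟩ := hargs i
    rw [hy] at hi
    exact ⟨i, hy ▸ Eq.symm hi⟩

theorem mem_extSyms_clause {K : Set (Clause (F.sum E) P X)} {D : Clause (F.sum E) P X}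
    (hD : D ∈ K) {f : E.Sym} {args : ∀ i, Term (F.sum E) X ((F.sum E).dom (Sum.inr f) i)}
    (h : (⟨_, .app (Sum.inr f) args⟩ : Σ s, Term (F.sum E) X s) ∈ (Clause.toQF D).subterms) :
    f ∈ extSyms (clauseSet K) :=
  ⟨args, subterms_clause_subset hD h⟩

theorem SortConditions.sort_mem (hA : SortConditions Ks K1 Ss' S1) {D : Clause (F.sum E) P X}
    (hD : D ∈ Ks) {s : S} {x : X s}
    (hx : (⟨s, .var x⟩ : Σ s, Term (F.sum E) X s) ∈ (Clause.toQF D).subterms) : s ∈ S1 := by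
  obtain ⟨f, args, h, i, hi⟩ :=
    exists_arg_eq_var (hA.flat D (Or.inl hD)) (hA.vars_below D (Or.inl hD)) hx
  have hs := hA.input f (hA.syms_Ks (mem_extSyms_clause hD h)) i
  have : (F.sum E).dom (Sum.inr f) i = s := congrArg Sigma.fst hi
  rwa [← this]

/-- The variables of `Ks` have sorts in `S1`, so any substitution replaces them by shared constants
and all resulting extension terms lie in `T`. No instance of `Ks` that locality may ask for is
missing from `Ks[T]`. -/
theorem SortConditions.subst_mem_instances (hA : SortConditions Ks K1 Ss' S1)
    {D : Clause (F.sum E) P X} (hD : D ∈ Ks) (σ : ∀ s, X s → Term (F.sum E) C s) :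
    Clause.subst σ D ∈ instances Ks (sharedTerms F C Ss') := by
  refine ⟨D, hD, σ, rfl, ?_⟩
  rintro q ⟨hq, hq'⟩
  rw [subterms_singleton, Clause.toQF_subst] at hq
  rcases QF.fromSubst σ _ hq with ⟨f, args, h, rfl⟩ | ⟨s, x, h, h'⟩
  · rcases f with f | f
    · exact hq'.elim
    · have hf := hA.syms_Ks (mem_extSyms_clause hD h)
      exact ⟨f, hf, _, fun i => hA.isSharedConst (hA.input f hf i) _, rfl⟩
  · have hs := hA.isSharedConst (hA.sort_mem hD h) (σ s x)
    rw [hs.subterms_eq] at h'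
    cases h'
    exact hs.mem_sharedTerms hq'

/-- Together with the assumption that constants of sorts in `S1` occur in `G`, this shows that
`Ks[T]` adds no constants to those of `G`. -/
theorem SortConditions.consts_instances (hA : SortConditions Ks K1 Ss' S1) {c : Σ s, C s}
    (hc : c ∈ consts (clauseSet (instances Ks (sharedTerms F C Ss')))) : c.1 ∈ S1 := by
  obtain ⟨_, ⟨D, hD, σ, rfl, -⟩, hc⟩ := mem_subterms_clauseSet.1 hc
  rw [Clause.toQF_subst] at hc
  rcases QF.fromSubst σ _ hc with ⟨f, args, -, h⟩ | ⟨s, x, h, h'⟩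
  · exact (Term.var_ne_app h).elim
  · have hs := hA.sort_mem hD h
    rw [(hA.isSharedConst hs (σ s x)).subterms_eq] at h'
    have : c.1 = s := congrArg Sigma.fst h'
    rwa [this]

theorem extSyms_instances_sharedTerms :
    extSyms (clauseSet (instances Ks (sharedTerms F C Ss'))) ⊆ Ss' := by
  rintro f ⟨args, h⟩
  obtain ⟨D, hD, h⟩ := mem_subterms_clauseSet.1 h
  obtain ⟨D', -, σ, rfl, hD⟩ := hD
  have hm : (⟨_, .app (Sum.inr f) args⟩ : Σ s, Term (F.sum E) C s) ∈
      extTerms {Clause.toQF (Clause.subst σ D')} := ⟨by rwa [subterms_singleton], trivial⟩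
  exact extSym_mem_of_sharedTerms (hD hm) (Term.mem_subterms_self _)

end SortConditions

/-! ### Uniform interpolants in the extension by uninterpreted symbols -/

/-- The candidate eliminates from the purified `Γ` and its congruence axioms everything but the
shared vocabulary over `Cs`. For a model of it, the witnesses are moved off the values used by `θ`,
and the symbols of `Ss'` are redefined by them: `Γ` becomes true while `θ` keeps its truth value. -/
theorem exists_uniformInterpolant {T₀ : Set (Sentence F P)} (heq : IsEqInterpolating T₀)
    (hqe : HasQE T₀) {Ks K1 : Set (Clause (F.sum E) P X)} {Ss' : Set E.Sym} {S1 : Set S}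
    (hA : SortConditions Ks K1 Ss' S1) (hT : (sharedTerms F C Ss').Finite)
    (Γ : QF (F.sum E) P C) (hΓ : extSyms {Γ} ⊆ Ss') (Cs : Set (Σ s, C s)) :
    ∃ ψ : QF (F.sum E) P C, extSyms {ψ} ⊆ Ss' ∧
      IsUniformInterpolant (uifModels T₀ E) Γ Cs ψ := by
  classical
  -- The shared terms are included because the congruence axioms must also cover terms over `Cs`
  -- that match an argument tuple of `θ` but do not occur in `Γ`.
  let Def : Set (Σ s, Term (F.sum E) C s) := extTerms {Γ} ∪ sharedTerms F C Ss'
  have hDef : Def.Finite := (finite_extTerms (Set.finite_singleton Γ)).union hT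
  obtain ⟨γ, -, hγ⟩ := exists_conj ((finite_conClauses (P := P) hDef).image Clause.toQF)
  have hγ' : ∀ (B : Struct F P) (w : B.Val (PureConst F E C)),
      γ.Realize B w ↔ IsCongruent B w Def := fun B w => by
    rw [hγ, ← realize_conClauses (P := P)]
    exact realize_clauseSet B w _
  -- Kept are the constants of `Cs` and the `c_t` for shared terms `t` over `Cs`.
  let A : ∀ s, PureConst F E C s → Prop := fun s c => varsIn c.back.subterms ⊆ Cs ∧
    (c.back.IsExt → (⟨s, c.back⟩ : Σ s, Term (F.sum E) C s) ∈ sharedTerms F C Ss')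
  obtain ⟨χ, hχ⟩ := hqe.exists_eliminate A (.conj Γ.purify γ)
  refine ⟨χ.lift fun _ c => c.1.back, ?_, ?_, ?_, ?_⟩
  · rintro f ⟨args, h⟩
    rw [subterms_singleton] at h
    rcases QF.fromLift _ _ h with ⟨g, b, h'⟩ | ⟨s, c, h'⟩
    · exact (Term.baseApp_ne_extApp h'.symm).elim
    · rcases c.1.isExt_back_or with hc | ⟨x, hx⟩
      · exact extSym_mem_of_sharedTerms (c.2.2 hc) h'
      · change _ ∈ c.1.back.subterms at h'
        rw [hx] at h'
        exact (Term.var_ne_app (Eq.symm h')).elim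
  · rintro c h
    rw [consts, subterms_singleton] at h
    rcases QF.fromLift _ _ h with ⟨g, b, h⟩ | ⟨s, c', h⟩
    · exact (Term.var_ne_app h).elim
    · exact c'.2.1 h
  · intro N hN v h
    refine (QF.realize_lift N v _ χ).2 ((hχ _ hN _).2 ⟨N.pureVal v, fun s c => rfl, ?_, ?_⟩)
    · exact (Agrees.realize_iff Γ (agrees_pureVal N v _)).1 (h Γ rfl)
    · exact (hγ' _ _).2 (isCongruent_pureVal N v Def)
  · intro Z θ hθ hent N hN v hψ
    replace hψ := hψ _ rfl
    obtain ⟨w, hw, hwφ⟩ := (hχ _ hN _).1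
      ((QF.realize_lift _ _ _ χ).1 ((QF.realize_subst _ _ _ _).1 hψ))
    let v₀ : N.Val C := fun s c => v s (Sum.inl c)
    replace hw : ∀ s (c : PureConst F E C s), A s c → w s c = c.back.eval N v₀ :=
      fun s c hc => hw s ⟨c, hc⟩
    let vals : Set (Σ s, N.carrier s) :=
      (fun p : Σ s, Term (F.sum E) (fun s => C s ⊕ Z s) s => ⟨p.1, p.2.eval N v⟩) '' θ.subterms
    let kept : Set (Σ s, N.carrier s) := {p | ∃ t : Term (F.sum E) C p.1,
      varsIn t.subterms ⊆ Cs ∧ t.eval N v₀ = p.2}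
    -- The values to be vacated: those of subterms of `θ`, in sorts of `S1`, that are not the value
    -- of a term over `Cs`. Kept constants do not take such values, so moving leaves them fixed.
    let L : Set (Σ s, N.carrier s) := (vals ∩ {p | p.1 ∈ S1}) \ kept
    have hL : L.Finite := ((θ.finite_subterms.image _).inter_of_left _).sdiff
    obtain ⟨r, hr1, hr2, hr3⟩ := exists_move_values hqe heq _ hN w hwφ hL
      fun p hp => hA.cod_ne hp.1.2
    let w' : N.reduct.Val (PureConst F E C) := fun s c => r s (w s c)
    have hcon : IsCongruent N.reduct w' Def := (hγ' _ _).1 hr3.2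
    have hw' : ∀ s (c : PureConst F E C s), A s c → w' s c = c.back.eval N v₀ := by
      intro s c hc
      rw [← hw s c hc]
      exact hr1 _ _ fun h => h.2 ⟨c.back, hc.1, (hw s c hc).symm⟩
    let g := N.redefineFn w' Def Ss'
    let v' : N.Val fun s => C s ⊕ Z s := fun s c => match c with
      | .inl c => if (⟨s, c⟩ : Σ s, C s) ∈ consts {Γ} then w' s (.inl c) else v s (.inl c)
      | .inr z => v s (.inr z)
    have hA_var : ∀ s (c : C s), (⟨s, c⟩ : Σ s, C s) ∈ Cs → A s (.inl c) := by
      intro s c hc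
      refine ⟨?_, fun h => h.elim⟩
      rintro c' h
      obtain ⟨s', c'⟩ := c'
      cases h
      exact hc
    have hΓ' : (Γ.subst fun _ c => .var (Sum.inl c)).Realize (N.reduct.withExt g) v' := by
      refine (QF.realize_subst _ _ _ _).2 ?_
      refine (Agrees.realize_iff (M := N.reduct.withExt g) (w := w') Γ ⟨?_, ?_⟩).2 hr3.1
      · intro s c hc
        exact if_pos (show _ ∈ consts {Γ} by
          rw [consts, subterms_singleton]
          exact hc)
      · intro f args ha
        rw [← subterms_singleton Γ] at ha
        exact redefineFn_of_mem hcon (hΓ ⟨args, ha⟩) (Or.inl ⟨ha, trivial⟩) fun i => rfl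
    have hθ' := hent (N.reduct.withExt g) hN v' (by rintro _ rfl; exact hΓ')
    refine (realize_withExt N g v v' θ ?_ ?_).1 hθ'
    · rintro s (c | z) hc
      · by_cases h : (⟨s, c⟩ : Σ s, C s) ∈ consts {Γ}
        · exact (if_pos h).trans (hw' s _ (hA_var s c
            (hθ s c (by rw [consts, subterms_singleton]; exact hc) h)))
        · exact if_neg h
      · rfl
    · intro f args ha
      by_cases hex : ∃ b : ∀ i, Term (F.sum E) C ((F.sum E).dom (Sum.inr f) i), f ∈ Ss' ∧
          (⟨_, .app (Sum.inr f) b⟩ : Σ s, Term (F.sum E) C s) ∈ Def ∧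
          ∀ i, (b i).purify.eval N.reduct w' = (args i).eval N v
      swap
      · exact redefineFn_of_not fun b hf hb h => hex ⟨b, hf, hb, h⟩
      obtain ⟨b, hf, hb, hbv⟩ := hex
      -- An argument value of `θ` that is hit by a moved witness lies outside `L`, hence is the
      -- value of a term over `Cs`.
      have hkept : ∀ i, ∃ t : Term (F.sum E) C ((F.sum E).dom (Sum.inr f) i),
          varsIn t.subterms ⊆ Cs ∧ t.eval N v₀ = (args i).eval N v := by
        intro i
        by_contra hc
        obtain ⟨c, hbc, -⟩ := (hA.isSharedConst (hA.input f hf i) (b i)).exists_purify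
        refine hr2 _ (w _ c) ?_
        have h2 : r _ (w _ c) = (args i).eval N v :=
          (congrArg (Term.eval N.reduct w') hbc).symm.trans (hbv i)
        rw [h2]
        exact ⟨⟨⟨⟨_, args i⟩, QF.subterms_subset θ ha (Term.arg_mem_subterms _ args i), rfl⟩,
          hA.input f hf i⟩, hc⟩
      choose d hd hdv using hkept
      have hshared := fun i => hA.isSharedConst (hA.input f hf i) (d i)
      have hdmem : (⟨_, .app (Sum.inr f) d⟩ : Σ s, Term (F.sum E) C s) ∈ sharedTerms F C Ss' :=
        ⟨f, hf, d, hshared, rfl⟩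
      have hdA : A _ (.ofApp f d) := by
        refine ⟨?_, fun _ => hdmem⟩
        rintro c (hc | hc)
        · exact (Term.var_ne_app hc).elim
        · obtain ⟨i, hi⟩ := Set.mem_iUnion.1 hc
          exact hd i hi
      -- The tuple is therefore also the argument tuple of the shared term `f(d)` over `Cs`. Its
      -- constant is kept, so the redefined value is the original one.
      refine (redefineFn_of_mem hcon hf (Or.inr hdmem) fun i => ?_).trans
        ((hw' _ _ hdA).trans (congrArg (N.fn (Sum.inr f)) (funext hdv)))
      obtain ⟨c, hdc, hcd⟩ := (hshared i).exists_purify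
      have hc : A _ c := by
        refine ⟨hcd ▸ hd i, fun h => ?_⟩
        rw [hcd] at h ⊢
        exact (hshared i).mem_sharedTerms h
      exact (congrArg (Term.eval N.reduct w') hdc).trans
        ((hw' _ c hc).trans ((congrArg (Term.eval N v₀) hcd).trans (hdv i)))

/-! ### Consequences of locality -/

theorem realize_of_mem_instances {T₀ : Set (Sentence F P)} {K : Set (Clause (F.sum E) P X)}
    {M : Struct (F.sum E) P} (hM : M ∈ extModels T₀ K) (v : M.Val C)
    {T : Set (Σ s, Term (F.sum E) C s)} {D : Clause (F.sum E) P C} (hD : D ∈ instances K T) :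
    Clause.Realize M v D := by
  obtain ⟨D, hD, σ, rfl, -⟩ := hD
  exact (Clause.realize_subst M v σ D).2 (hM.2 D hD _)

theorem extModels_union_subset (T₀ : Set (Sentence F P)) (K K' : Set (Clause (F.sum E) P X)) :
    extModels T₀ (K ∪ K') ⊆ extModels T₀ K' :=
  fun _ hM => ⟨hM.1, fun D hD => hM.2 D (Or.inr hD)⟩

section Local

variable {T₀ : Set (Sentence F P)} {Ks K1 : Set (Clause (F.sum E) P X)} {Ss' : Set E.Sym}
  {S1 : Set S}

/-- By locality, a set of ground clauses that contains `Ks[T]` is satisfiable if it holds in a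
structure together with the relevant instances of `K1`. -/
theorem exists_model_of_isLocal (hloc : IsLocal T₀ (Ks ∪ K1))
    (hA : SortConditions Ks K1 Ss' S1) {H : Set (Clause (F.sum E) P C)} (hfin : H.Finite)
    (hKs : instances Ks (sharedTerms F C Ss') ⊆ H) {M : Struct (F.sum E) P}
    (hM : M.reduct.IsModel T₀) (v : M.Val C) (hH : ∀ D ∈ H, Clause.Realize M v D)
    (hK1 : ∀ D ∈ instances K1 (est (Ks ∪ K1) H), Clause.Realize M v D) :
    ∃ N ∈ extModels T₀ (Ks ∪ K1), ∃ v : N.Val C, ∀ D ∈ H, Clause.Realize N v D := by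
  by_contra! hcon
  have hunsat : Entails (extModels T₀ (Ks ∪ K1)) (clauseSet H) .falsum := by
    intro N hN v hv
    obtain ⟨D, hD, h⟩ := hcon N hN v
    exact h ((realize_clauseSet N v H).1 hv D hD)
  refine (hloc C H hfin).1 hunsat M hM v ((realize_clauseSet M v _).2 ?_)
  rintro D (⟨D, hD | hD, σ, rfl, h⟩ | hD)
  · exact hH _ (hKs (hA.subst_mem_instances hD σ))
  · exact hK1 _ ⟨D, hD, σ, rfl, h⟩
  · exact hH D hD

/-- What `G` entails modulo the full theory, `G ∧ Ks[T]` already entails modulo `T₀ ∪ K1`: a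
countermodel satisfies all the instances required by locality. `Ks[T]` adds only symbols of `Ss'`
and constants of `G`, so the vocabulary conditions on `θ` transfer. -/
theorem IsGenUniformInterpolant.of_instances (hloc : IsLocal T₀ (Ks ∪ K1))
    (hA : SortConditions Ks K1 Ss' S1) {G : Set (Clause (F.sum E) P C)} (hG : G.Finite)
    (hC : ∀ s ∈ S1, ∀ c : C s, (⟨s, c⟩ : Σ s, C s) ∈ ManySorted.consts (clauseSet G))
    (hfin : (instances Ks (sharedTerms F C Ss')).Finite) {Cs : Set (Σ s, C s)}
    {ψ : QF (F.sum E) P C}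
    (hψ : IsGenUniformInterpolant (extModels T₀ K1)
      (clauseSet (G ∪ instances Ks (sharedTerms F C Ss'))) Ss' Cs ψ) :
    IsGenUniformInterpolant (extModels T₀ (Ks ∪ K1)) (clauseSet G) Ss' Cs ψ := by
  refine ⟨hψ.syms, hψ.consts, ?_, ?_⟩
  · intro M hM v hv
    refine hψ.entails M (extModels_union_subset _ _ _ hM) v ((realize_clauseSet M v _).2 ?_)
    rintro D (hD | hD)
    · exact (realize_clauseSet M v _).1 hv D hD
    · obtain ⟨D', hD', σ, rfl, -⟩ := hD
      exact (Clause.realize_subst M v σ D').2 (hM.2 D' (Or.inl hD') _)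
  · intro θ hsyms hconsts hθ M hM
    refine hψ.strongest θ ?_ ?_ ?_ M (extModels_union_subset _ _ _ hM)
    · rintro f ⟨h, args, h'⟩
      rw [clauseSet_union, subterms_union] at h'
      rcases h' with h' | h'
      · exact hsyms ⟨h, args, h'⟩
      · exact extSyms_instances_sharedTerms ⟨args, h'⟩
    · rintro c ⟨h, h'⟩
      refine hconsts ⟨h, ?_⟩
      rw [ManySorted.consts, clauseSet_union, subterms_union] at h'
      rcases h' with h' | h'
      · exact h'
      · exact hC _ (hA.consts_instances h') c.2
    · intro M hM v hv
      by_contra hnθ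
      obtain ⟨L, hL, -, hLθ⟩ := (exists_cnf θ).2
      obtain ⟨N, hN, w, hw⟩ := exists_model_of_isLocal hloc hA
        (H := (G ∪ instances Ks (sharedTerms F C Ss')) ∪ L) ((hG.union hfin).union hL)
        (fun D hD => Or.inl (Or.inr hD)) hM.1 v
        (by
          rintro D (hD | hD)
          · exact (realize_clauseSet M v _).1 hv D hD
          · exact (hLθ M v).2 hnθ D hD)
        fun D hD => realize_of_mem_instances hM v hD
      exact (hLθ N w).1 (fun D hD => hw D (Or.inr hD)) (hθ N hN w
        ((realize_clauseSet N w _).2 fun D hD => hw D (Or.inl (Or.inl hD))))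

end Local

/-! ### Ground extension terms -/

theorem nullary_args_eq {f : E.Sym} (hf : E.arity f = 0)
    (a b : ∀ i, Term (F.sum E) V ((F.sum E).dom (Sum.inr f) i)) : a = b :=
  funext fun i => (Fin.cast hf i).elim0

/-- A ground extension term in a flat clause has no arguments, since an argument would have to be a
variable. -/
theorem mem_est {K : Set (Clause (F.sum E) P X)} (hflat : ∀ D ∈ K, Clause.IsFlat D)
    {G : Set (Clause (F.sum E) P C)} {p : Σ s, Term (F.sum E) C s} (hp : p ∈ est K G) :
    p ∈ extTerms (clauseSet G) ∨ ∃ f ∈ extSyms (clauseSet K), E.arity f = 0 ∧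
      ∃ args : ∀ i, Term (F.sum E) C ((F.sum E).dom (Sum.inr f) i),
        p = ⟨_, .app (Sum.inr f) args⟩ := by
  refine hp.imp id ?_
  rintro ⟨s, t, ⟨ht, ht'⟩, rfl⟩
  cases t with
  | var x => exact x.elim
  | app f args =>
    rcases f with f | f
    · exact ht'.elim
    · refine ⟨f, ⟨_, ht⟩, ?_, _, rfl⟩
      by_contra hf
      obtain ⟨D, hD, h⟩ := mem_subterms_clauseSet.1 ht
      obtain ⟨x, hx⟩ := hflat D hD f _ (by rw [subterms_singleton]; exact h)
        ⟨0, Nat.pos_of_ne_zero hf⟩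
      have : ∀ {s : S} (t : Term (F.sum E) (fun _ => PEmpty.{u + 1}) s) (x : X s),
          t.subst (fun _ x => x.elim) ≠ Term.var x := by
        intro s t x h
        cases t with
        | var x => exact x.elim
        | app f args => exact Term.var_ne_app (congrArg (Sigma.mk _) h.symm)
      exact this _ _ hx

theorem nullary_mem_est {K : Set (Clause (F.sum E) P X)} {G : Set (Clause (F.sum E) P C)}
    {f : E.Sym} (hf : f ∈ extSyms (clauseSet K)) (hf' : E.arity f = 0)
    (args : ∀ i, Term (F.sum E) C ((F.sum E).dom (Sum.inr f) i)) :
    (⟨_, .app (Sum.inr f) args⟩ : Σ s, Term (F.sum E) C s) ∈ est K G := by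
  obtain ⟨a, ha⟩ := hf
  let t : Term (F.sum E) (fun _ => PEmpty.{u + 1}) _ :=
    .app (F := F.sum E) (Sum.inr f) fun i : Fin (E.arity f) => (Fin.cast hf' i).elim0
  refine Or.inr ⟨_, t, ⟨?_, trivial⟩, ?_⟩
  · rw [nullary_args_eq hf' a] at ha
    exact ha
  · exact congrArg (fun a => (⟨_, .app (Sum.inr f) a⟩ : Σ s, Term (F.sum E) C s))
      (nullary_args_eq hf' _ _)

/-! ### Results of the elimination algorithm -/

section Elimination

variable {T₀ : Set (Sentence F P)} {Ks K1 : Set (Clause (F.sum E) P X)} {Ss' : Set E.Sym}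
  {S1 : Set S}

/-- All clauses of Step 1 together are finite in number, hence form one quantifier-free formula to
which quantifier elimination applies. -/
theorem exists_isEliminationResult (hqe : HasQE T₀) (hA : SortConditions Ks K1 Ss' S1)
    {H : Set (Clause (F.sum E) P C)} (hH : H.Finite) (Cs : Set (Σ s, C s)) :
    ∃ Γ, IsEliminationResult T₀ K1 H (est K1 H) Ss' Cs Γ := by
  have hfin : (instances K1 (est K1 H) ∪ H).Finite :=
    (finite_instances hA.finite_K1 (fun D hD => hA.vars_below D (Or.inr hD))
      (finite_est hA.finite_K1 hH)).union hH
  have hstep : (stepOne K1 H (est K1 H)).Finite :=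
    (hfin.image _).union (finite_conClauses (finite_extTerms (hfin.image _)))
  obtain ⟨φ, -, hφ⟩ := exists_conj (hstep.image Clause.toQF)
  obtain ⟨Γ₁, hΓ₁⟩ := hqe.exists_eliminate
    (Keep (extTerms (clauseSet (instances K1 (est K1 H) ∪ H))) Ss' Cs) φ
  refine ⟨_, Γ₁, fun M hM v => ?_, rfl⟩
  refine (hΓ₁ M hM v).trans (exists_congr fun w => and_congr Iff.rfl ?_)
  exact (hφ M w).trans (realize_clauseSet M w _)

/-- Instances of `K1` contribute no term rooted in `Ss'` that is not already in `H`: beyond the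
terms of `H`, they only use nullary symbols of `K1`. -/
theorem SortConditions.mem_extTerms (hA : SortConditions Ks K1 Ss' S1)
    {H : Set (Clause (F.sum E) P C)} {f : E.Sym} (hf : f ∈ Ss')
    {args : ∀ i, Term (F.sum E) C ((F.sum E).dom (Sum.inr f) i)}
    (h : (⟨_, .app (Sum.inr f) args⟩ : Σ s, Term (F.sum E) C s) ∈
      extTerms (clauseSet (instances K1 (est K1 H) ∪ H))) :
    (⟨_, .app (Sum.inr f) args⟩ : Σ s, Term (F.sum E) C s) ∈ extTerms (clauseSet H) := by
  rw [clauseSet_union, extTerms_union] at h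
  rcases h with ⟨h, -⟩ | h
  · obtain ⟨_, ⟨D, hD, σ, rfl, hext⟩, h⟩ := mem_subterms_clauseSet.1 h
    have hm : (⟨_, .app (Sum.inr f) args⟩ : Σ s, Term (F.sum E) C s) ∈
      extTerms {Clause.toQF (Clause.subst σ D)} := ⟨by rwa [subterms_singleton], trivial⟩
    rcases mem_est (fun D hD => hA.flat D (Or.inr hD)) (hext hm) with h | ⟨g, hg, -, b, h⟩
    · exact h
    · cases Term.extApp_inj h
      exact (hA.syms_K1 hg hf).elim
  · exact h

theorem IsEliminationResult.extSyms_subset (hA : SortConditions Ks K1 Ss' S1)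
    {H : Set (Clause (F.sum E) P C)} {Cs : Set (Σ s, C s)} {Γ : QF (F.sum E) P C}
    (hΓ : IsEliminationResult T₀ K1 H (est K1 H) Ss' Cs Γ) : extSyms {Γ} ⊆ Ss' := by
  obtain ⟨Γ₁, -, rfl⟩ := hΓ
  rintro f ⟨args, h⟩
  rw [subterms_singleton] at h
  rcases QF.fromLift _ _ h with ⟨g, b, h'⟩ | ⟨s, ⟨c | t, hc⟩, h'⟩
  · exact (Term.baseApp_ne_extApp h'.symm).elim
  · exact (Term.var_ne_app (Eq.symm h')).elim
  · change _ ∈ t.1.subterms at h'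
    obtain ⟨-, g, hg, b, hb⟩ := hc
    refine extSym_mem_of_sharedTerms (p := ⟨s, t.1⟩) ?_ h'
    exact ⟨g, hg, b, fun i => hA.isSharedConst (hA.input g hg i) _, hb⟩

theorem IsEliminationResult.consts_subset (hA : SortConditions Ks K1 Ss' S1)
    {H : Set (Clause (F.sum E) P C)} {Cs : Set (Σ s, C s)} {Γ : QF (F.sum E) P C}
    (hΓ : IsEliminationResult T₀ K1 H (est K1 H) Ss' Cs Γ) :
    consts {Γ} ⊆ keptConsts (extTerms (clauseSet H)) Ss' Cs := by
  obtain ⟨Γ₁, -, rfl⟩ := hΓ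
  rintro c h
  rw [consts, subterms_singleton] at h
  rcases QF.fromLift _ _ h with ⟨g, b, h'⟩ | ⟨s, ⟨c' | t, hc⟩, h'⟩
  · exact (Term.var_ne_app h').elim
  · have : c = ⟨s, c'⟩ := by
      obtain ⟨s₁, c⟩ := c
      cases (show (⟨s₁, .var c⟩ : Σ s, Term (F.sum E) C s) = ⟨s, .var c'⟩ from h')
      rfl
    subst this
    refine hc.imp id ?_
    rintro ⟨f, hf, args, h, hi⟩
    exact ⟨f, hf, args, hA.mem_extTerms hf h, hi⟩
  · obtain ⟨hm, g, hg, b, hb⟩ := hc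
    rw [hb] at hm
    have h2 : (⟨c.1, .var c.2⟩ : Σ s, Term (F.sum E) C s) ∈
        (⟨s, t.1⟩ : Σ s, Term (F.sum E) C s).2.subterms := h'
    rw [hb] at h2
    rcases h2 with h2 | h2
    · exact (Term.var_ne_app h2).elim
    · obtain ⟨i, hi⟩ := Set.mem_iUnion.1 h2
      exact Or.inr ⟨g, hg, b, hA.mem_extTerms hg hm, i,
        (Set.ext_iff.1 (hA.isSharedConst (hA.input g hg i) (b i)).subterms_eq _).1 hi⟩

theorem keptConsts_subset {H : Set (Clause (F.sum E) P C)} {Cs : Set (Σ s, C s)}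
    (hCs : Cs ⊆ consts (clauseSet H)) :
    keptConsts (extTerms (clauseSet H)) Ss' Cs ⊆ consts (clauseSet H) := by
  rintro c (hc | ⟨f, -, args, ⟨h, -⟩, i, hi⟩)
  · exact hCs hc
  · change (⟨c.1, .var c.2⟩ : Σ s, Term (F.sum E) C s) ∈ subterms (clauseSet H)
    rw [hi]
    exact subterms_subset h (Term.arg_mem_subterms _ args i)

end Elimination

/-! ### Transfer of entailment from `G ∧ Ks[T]` to the elimination result -/

theorem Agrees.of_subset {M : Struct (F.sum E) P} {v : M.Val C}
    {w : M.reduct.Val (PureConst F E C)} {U U' : Set (Σ s, Term (F.sum E) C s)}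
    (h : Agrees M v w U)
    (hvar : ∀ s (c : C s), (⟨s, .var c⟩ : Σ s, Term (F.sum E) C s) ∈ U' →
      (⟨s, .var c⟩ : Σ s, Term (F.sum E) C s) ∈ U)
    (hext : ∀ (f : E.Sym) (args : ∀ i, Term (F.sum E) C ((F.sum E).dom (Sum.inr f) i)),
      (⟨_, .app (Sum.inr f) args⟩ : Σ s, Term (F.sum E) C s) ∈ U' →
      (⟨_, .app (Sum.inr f) args⟩ : Σ s, Term (F.sum E) C s) ∈ U) : Agrees M v w U' :=
  ⟨fun s c hc => h.1 s c (hvar s c hc), fun f args ha => h.2 f args (hext f args ha)⟩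

/-- If the extension terms of a flat clause are mapped to terms in a set `U` closed under subterms,
then so are all constants and extension terms of the instance. -/
theorem instance_subterms {D : Clause (F.sum E) P X} (hflat : Clause.IsFlat D)
    (hvars : Clause.VarsBelowExt D) {σ : ∀ s, X s → Term (F.sum E) C s}
    {U : Set (Σ s, Term (F.sum E) C s)} (hU : ∀ p ∈ U, p.2.subterms ⊆ U)
    (h : ∀ (f : E.Sym) (args : ∀ i, Term (F.sum E) X ((F.sum E).dom (Sum.inr f) i)),
      (⟨_, .app (Sum.inr f) args⟩ : Σ s, Term (F.sum E) X s) ∈ (Clause.toQF D).subterms →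
      1 ≤ E.arity f →
      (⟨_, (Term.app (F := F.sum E) (Sum.inr f) args).subst σ⟩ : Σ s, Term (F.sum E) C s) ∈ U)
    {q : Σ s, Term (F.sum E) C s} (hq : q ∈ (Clause.toQF (Clause.subst σ D)).subterms) :
    q ∈ U ∨ ∃ (f : (F.sum E).Sym) (args : ∀ i, Term (F.sum E) X ((F.sum E).dom f i)),
      (⟨_, .app f args⟩ : Σ s, Term (F.sum E) X s) ∈ (Clause.toQF D).subterms ∧
      q = ⟨_, (Term.app f args).subst σ⟩ := by
  rw [Clause.toQF_subst] at hq
  rcases QF.fromSubst σ _ hq with hq | ⟨s, x, hx, hq⟩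
  · exact Or.inr hq
  · obtain ⟨f, args, hf, i, hi⟩ := exists_arg_eq_var hflat hvars hx
    have hmem := hU _ (h f args hf (Nat.lt_of_le_of_lt (Nat.zero_le _) i.2))
    have : ∀ {p p' : Σ s, Term (F.sum E) X s}, p = p' → q ∈ (p'.2.subst σ).subterms →
        q ∈ (p.2.subst σ).subterms := by
      rintro p p' rfl h
      exact h
    exact Or.inl (hmem (Term.arg_subterms_subset (F := F.sum E) (Sum.inr f)
      (fun i => (args i).subst σ) i (this hi hq)))

section Elimination

variable {T₀ : Set (Sentence F P)} {Ks K1 : Set (Clause (F.sum E) P X)} {Ss' : Set E.Sym}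
  {S1 : Set S}

/-- If `θ` failed in `N`, the witnesses for the eliminated constants would turn `N` into a structure
satisfying `H`, `¬θ` and the instances of `K1` needed for locality. This would yield a model of `H ∧
¬θ`. The premise `hR` supplies the instances that speak only about terms of `¬θ`. -/
theorem eq_true_of_eliminationResult (hloc : IsLocal T₀ (Ks ∪ K1))
    (hA : SortConditions Ks K1 Ss' S1) {H : Set (Clause (F.sum E) P C)} (hH : H.Finite)
    (hKs : instances Ks (sharedTerms F C Ss') ⊆ H)
    (hE : theta (Ks ∪ K1) (extSyms (clauseSet H) \ Ss') ⊆ extSyms (clauseSet H))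
    {Cs : Set (Σ s, C s)} {Γ : QF (F.sum E) P C}
    (hΓ : IsEliminationResult T₀ K1 H (est K1 H) Ss' Cs Γ) {θ : QF (F.sum E) P C}
    (hsyms : extSyms {θ} ∩ extSyms (clauseSet H) ⊆ Ss')
    (hconsts : consts {θ} ∩ consts (clauseSet H) ⊆ Cs)
    (hent : Entails (extModels T₀ K1) (clauseSet H) θ)
    {L : Set (Clause (F.sum E) P C)} (hL : L.Finite)
    (hLsub : subterms (clauseSet L) ⊆ θ.subterms)
    (hLθ : ∀ (M : Struct (F.sum E) P) (v : M.Val C),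
      (∀ D ∈ L, Clause.Realize M v D) ↔ ¬ θ.Realize M v)
    {N : Struct (F.sum E) P} (hN : N.reduct.IsModel T₀) {v : N.Val C} (hΓv : Γ.Realize N v)
    (hR : ∀ D ∈ instances K1 (est K1 L), Clause.Realize N v D) : θ.Realize N v := by
  classical
  by_contra hθ
  obtain ⟨Γ₁, hΓ₁, rfl⟩ := hΓ
  let Def := extTerms (clauseSet (instances K1 (est K1 H) ∪ H))
  obtain ⟨w, hw, hstep⟩ := (hΓ₁ N.reduct hN _).1 ((QF.realize_lift N v _ Γ₁).1 hΓv)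
  replace hw : ∀ s (c : PureConst F E C s), Keep Def Ss' Cs s c → w s c = c.back.eval N v :=
    fun s c hc => hw s ⟨c, hc⟩
  have hcon : IsCongruent N.reduct w Def :=
    (realize_conClauses (P := P) _ _ _).1 fun D hD => hstep D (Or.inr hD)
  -- Only symbols of `H` to be eliminated are redefined. None of them occurs in `θ`, and symbols of
  -- `Ss'` keep their meaning.
  let Q : Set E.Sym := {f | f ∉ Ss' ∧ f ∈ extSyms (clauseSet H)}
  let g := N.redefineFn w Def Q
  let v' : N.Val C := fun s c =>
    if (⟨s, c⟩ : Σ s, C s) ∈ consts (clauseSet H) then w s (.inl c) else v s c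
  have hDef : ∀ {p : Σ s, Term (F.sum E) C s}, p ∈ subterms (clauseSet H) → p.2.IsExt →
      p ∈ Def := by
    intro p hp hp'
    refine ⟨?_, hp'⟩
    rw [clauseSet_union, subterms_union]
    exact Or.inr hp
  have hagr : Agrees (N.reduct.withExt g) v' w (subterms (clauseSet H)) := by
    refine ⟨fun s c hc => if_pos hc, fun f args ha => ?_⟩
    have hmem := hDef ha trivial
    by_cases hf : f ∈ Ss'
    · have harg : ∀ i, (args i).purify.eval N.reduct w = (args i).eval N v := by
        intro i
        have hsh := hA.isSharedConst (hA.input f hf i) (args i)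
        obtain ⟨c, hc, hcb⟩ := hsh.exists_purify
        refine (congrArg (Term.eval N.reduct w) hc).trans
          ((hw _ c ?_).trans (congrArg (Term.eval N v) hcb))
        rcases c with c | t
        · exact Or.inr ⟨f, hf, args, hmem, i, congrArg (Sigma.mk _) hcb⟩
        · have ht : (⟨_, t.1⟩ : Σ s, Term (F.sum E) C s) = ⟨_, args i⟩ :=
            congrArg (Sigma.mk _) hcb
          refine ⟨?_, ?_⟩
          · refine hDef (ht ▸ subterms_subset ha (Term.arg_mem_subterms _ args i)) t.2
          · rcases hsh with ⟨c', hc'⟩ | ⟨e, he, -, a, h⟩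
            · have h := t.2
              rw [show t.1 = .var c' from hcb.trans hc'] at h
              exact h.elim
            · exact ⟨e, he, a, ht.trans h⟩
      refine (redefineFn_of_not (M := N) (w := w) (Def := Def) (Q := Q)
        (m := fun i => (args i).purify.eval N.reduct w) fun b hb => (hb.1 hf).elim).trans ?_
      exact (congrArg (N.fn (Sum.inr f)) (funext harg)).trans
        (hw _ (.ofApp f args) ⟨hmem, f, hf, args, rfl⟩).symm
    · exact redefineFn_of_mem (M := N) (Q := Q) hcon ⟨hf, args, ha⟩ hmem fun i => rfl
  have htransfer : ∀ φ : QF (F.sum E) P C,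
      (∀ s (c : C s), (⟨s, .var c⟩ : Σ s, Term (F.sum E) C s) ∈ φ.subterms →
        (⟨s, .var c⟩ : Σ s, Term (F.sum E) C s) ∈ θ.subterms) →
      (∀ (f : E.Sym) (args : ∀ i, Term (F.sum E) C ((F.sum E).dom (Sum.inr f) i)),
        (⟨_, .app (Sum.inr f) args⟩ : Σ s, Term (F.sum E) C s) ∈ φ.subterms → f ∉ Q) →
      (φ.Realize (N.reduct.withExt g) v' ↔ φ.Realize N v) := by
    intro φ h1 h2
    refine realize_withExt N g v v' φ (fun s c hc => ?_) fun f args ha => ?_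
    · by_cases h : (⟨s, c⟩ : Σ s, C s) ∈ consts (clauseSet H)
      · refine (if_pos h).trans (hw s (.inl c) (Or.inl (hconsts ⟨?_, h⟩)))
        rw [consts, subterms_singleton]
        exact h1 s c hc
      · exact if_neg h
    · exact redefineFn_of_not fun b hb => (h2 f args ha hb).elim
  have hθQ : ∀ (f : E.Sym) (args : ∀ i, Term (F.sum E) C ((F.sum E).dom (Sum.inr f) i)),
      (⟨_, .app (Sum.inr f) args⟩ : Σ s, Term (F.sum E) C s) ∈ θ.subterms → f ∉ Q := by
    intro f args ha hf
    rw [← subterms_singleton θ] at ha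
    exact hf.1 (hsyms ⟨⟨args, ha⟩, hf.2⟩)
  have hpure : ∀ D ∈ instances K1 (est K1 H) ∪ H,
      Agrees (N.reduct.withExt g) v' w (Clause.toQF D).subterms →
      Clause.Realize (N.reduct.withExt g) v' D := by
    intro D hD hag
    have h := (Clause.realize_toQF N.reduct w _).2 (hstep _ (Or.inl ⟨D, hD, rfl⟩))
    rw [Clause.toQF_purify] at h
    exact (Clause.realize_toQF _ _ D).1 ((Agrees.realize_iff _ hag).2 h)
  have hflat := fun D hD => hA.flat D (Or.inr hD : D ∈ Ks ∪ K1)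
  have hvars := fun D hD => hA.vars_below D (Or.inr hD : D ∈ Ks ∪ K1)
  have hHtrue : ∀ D ∈ H, Clause.Realize (N.reduct.withExt g) v' D := fun D hD =>
    hpure D (Or.inr hD) (hagr.mono (subterms_clause_subset hD))
  have hLtrue : ∀ D ∈ L, Clause.Realize (N.reduct.withExt g) v' D :=
    (hLθ _ _).2 fun h => hθ ((htransfer θ (fun _ _ h => h) hθQ).1 h)
  suffices hK1 : ∀ D ∈ instances K1 (est (Ks ∪ K1) (H ∪ L)),
      Clause.Realize (N.reduct.withExt g) v' D by
    obtain ⟨N', hN', u, hu⟩ := exists_model_of_isLocal hloc hA (H := H ∪ L) (hH.union hL)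
      (hKs.trans Set.subset_union_left) (M := N.reduct.withExt g) hN v'
      (fun D hD => hD.elim (hHtrue D) (hLtrue D)) hK1
    exact (hLθ N' u).1 (fun D hD => hu D (Or.inr hD)) (hent N' (extModels_union_subset _ _ _ hN')
      u ((realize_clauseSet N' u _).2 fun D hD => hu D (Or.inl hD)))
  rintro _ ⟨D, hD, σ, rfl, hext⟩
  have hest : ∀ (f : E.Sym) (args : ∀ i, Term (F.sum E) X ((F.sum E).dom (Sum.inr f) i)),
      (⟨_, .app (Sum.inr f) args⟩ : Σ s, Term (F.sum E) X s) ∈ (Clause.toQF D).subterms →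
      (⟨_, (Term.app (F := F.sum E) (Sum.inr f) args).subst σ⟩ : Σ s, Term (F.sum E) C s) ∈
        subterms (clauseSet H) ∨
      (⟨_, (Term.app (F := F.sum E) (Sum.inr f) args).subst σ⟩ : Σ s, Term (F.sum E) C s) ∈
        subterms (clauseSet L) ∨ E.arity f = 0 := by
    intro f args ha
    have hm : (⟨_, .app (Sum.inr f) args⟩ : Σ s, Term (F.sum E) X s) ∈
      extTerms {Clause.toQF D} := ⟨by rwa [subterms_singleton], trivial⟩
    rcases mem_est hA.flat (hext (subst_mem_extTerms hm)) with h | ⟨f', -, hf', b, h⟩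
    · rw [clauseSet_union, extTerms_union] at h
      exact h.imp And.left fun h => Or.inl h.1
    · have h' := Term.extApp_inj (f := f) (g := f') h
      cases (Sigma.mk.inj_iff.1 h').1
      exact Or.inr (Or.inr hf')
  -- Either the clause shares a symbol with `H`, and closure under `theta` then puts all its symbols
  -- in `H`, or it shares none.
  by_cases hcase : ∃ (f : E.Sym) (args : ∀ i, Term (F.sum E) X ((F.sum E).dom (Sum.inr f) i)),
      (⟨_, .app (Sum.inr f) args⟩ : Σ s, Term (F.sum E) X s) ∈ (Clause.toQF D).subterms ∧
      f ∈ extSyms (clauseSet H)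
  · obtain ⟨f₀, a₀, hf₀, hf₀H⟩ := hcase
    have hf₀' : f₀ ∉ Ss' := hA.syms_K1 (mem_extSyms_clause hD hf₀)
    have hall : ∀ (f : E.Sym) (args : ∀ i, Term (F.sum E) X ((F.sum E).dom (Sum.inr f) i)),
        (⟨_, .app (Sum.inr f) args⟩ : Σ s, Term (F.sum E) X s) ∈ (Clause.toQF D).subterms →
        (⟨_, (Term.app (F := F.sum E) (Sum.inr f) args).subst σ⟩ : Σ s, Term (F.sum E) C s) ∈
          subterms (clauseSet H) := by
      intro f args ha
      have hfH : f ∈ extSyms (clauseSet H) := by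
        refine hE ⟨f₀, ⟨hf₀H, hf₀'⟩, Relation.EqvGen.rel _ _ ⟨D, Or.inr hD, ⟨args, ?_⟩, a₀, ?_⟩⟩
        · rwa [subterms_singleton]
        · rwa [subterms_singleton]
      rcases hest f args ha with h | h | h
      · exact h
      -- A term from `L` would make its symbol common to `θ` and `H`, hence a member of `Ss'`, but
      -- clauses of `K1` have no symbols of `Ss'`.
      · have h1 := hLsub h
        rw [← subterms_singleton θ] at h1
        exact (hA.syms_K1 (mem_extSyms_clause hD ha) (hsyms ⟨⟨_, h1⟩, hfH⟩)).elim
      · obtain ⟨b, hb⟩ := hfH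
        rw [nullary_args_eq h b fun i => (args i).subst σ] at hb
        exact hb
    have hsub : ∀ {q : Σ s, Term (F.sum E) C s},
        q ∈ (Clause.toQF (Clause.subst σ D)).subterms → q ∈ subterms (clauseSet H) ∨
          ∃ (f : F.Sym) (args : ∀ i, Term (F.sum E) C ((F.sum E).dom (Sum.inl f) i)),
            q = ⟨_, .app (Sum.inl f) args⟩ := by
      intro q hq
      rcases instance_subterms (hflat D hD) (hvars D hD) (fun p hp => subterms_subset hp)
        (fun f args ha _ => hall f args ha) hq with h | ⟨f | f, args, ha, rfl⟩
      · exact Or.inl h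
      · exact Or.inr ⟨f, _, rfl⟩
      · exact Or.inl (hall f args ha)
    refine hpure _ (Or.inl ⟨D, hD, σ, rfl, ?_⟩) (hagr.of_subset ?_ ?_)
    · rintro q ⟨hq, hq'⟩
      rw [subterms_singleton] at hq
      rcases hsub hq with h | ⟨f, args, rfl⟩
      · exact Or.inl ⟨h, hq'⟩
      · exact hq'.elim
    · intro s c hc
      rcases hsub hc with h | ⟨f, args, h⟩
      · exact h
      · exact (Term.var_ne_app h).elim
    · intro f args ha
      rcases hsub ha with h | ⟨f, args, h⟩
      · exact h
      · exact (Term.baseApp_ne_extApp h.symm).elim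
  · have hnot : ∀ (f : E.Sym) (args : ∀ i, Term (F.sum E) X ((F.sum E).dom (Sum.inr f) i)),
        (⟨_, .app (Sum.inr f) args⟩ : Σ s, Term (F.sum E) X s) ∈ (Clause.toQF D).subterms →
        f ∉ extSyms (clauseSet H) := fun f args ha hf => hcase ⟨f, args, ha, hf⟩
    have hall : ∀ (f : E.Sym) (args : ∀ i, Term (F.sum E) X ((F.sum E).dom (Sum.inr f) i)),
        (⟨_, .app (Sum.inr f) args⟩ : Σ s, Term (F.sum E) X s) ∈ (Clause.toQF D).subterms →
        (⟨_, (Term.app (F := F.sum E) (Sum.inr f) args).subst σ⟩ : Σ s, Term (F.sum E) C s) ∈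
          subterms (clauseSet L) ∨ E.arity f = 0 := fun f args ha =>
      (hest f args ha).resolve_left fun h => hnot f args ha ⟨_, h⟩
    have hsub : ∀ {q : Σ s, Term (F.sum E) C s},
        q ∈ (Clause.toQF (Clause.subst σ D)).subterms → q ∈ subterms (clauseSet L) ∨
          ∃ (f : (F.sum E).Sym) (args : ∀ i, Term (F.sum E) X ((F.sum E).dom f i)),
          (⟨_, .app f args⟩ : Σ s, Term (F.sum E) X s) ∈ (Clause.toQF D).subterms ∧
          q = ⟨_, (Term.app f args).subst σ⟩ := fun hq =>
      instance_subterms (hflat D hD) (hvars D hD) (fun p hp => subterms_subset hp)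
        (fun f args ha hf => (hall f args ha).resolve_right (Nat.ne_of_gt hf)) hq
    -- The instance contains only constants of `θ` and no redefined symbol, so its truth is
    -- inherited from `N`, where it belongs to `K1[est(K1, L)]`.
    refine (Clause.realize_toQF _ _ _).1 ((htransfer _ ?_ ?_).2 ((Clause.realize_toQF N v _).2 ?_))
    · intro s c hc
      rcases hsub hc with h | ⟨f, args, -, h⟩
      · exact hLsub h
      · exact (Term.var_ne_app h).elim
    · intro f args ha
      rcases hsub ha with h | ⟨f' | f', args', h, h'⟩
      · exact hθQ f args (hLsub h)
      · exact (Term.baseApp_ne_extApp h'.symm).elim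
      · have h2 := Term.extApp_inj (f := f) (g := f') h'
        cases (Sigma.mk.inj_iff.1 h2).1
        exact fun hf => hnot f args' h hf.2
    · refine hR _ ⟨D, hD, σ, rfl, ?_⟩
      rintro q ⟨hq, hq'⟩
      rw [subterms_singleton] at hq
      rcases hsub hq with h | ⟨f | f, args, h, rfl⟩
      · exact Or.inl ⟨h, hq'⟩
      · exact hq'.elim
      · rcases hall f args h with h' | h'
        · exact Or.inl ⟨h', trivial⟩
        · exact nullary_mem_est (mem_extSyms_clause hD h) h' _

/-- Needed so that guarding `θ` by `K1[est(K1, L)]` introduces no new constants, as the constants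
shared with `Γ` must stay in `Cs`. -/
theorem varsIn_instances_est (hA : SortConditions Ks K1 Ss' S1)
    {L : Set (Clause (F.sum E) P C)} {c : Σ s, C s}
    (hc : c ∈ consts (clauseSet (instances K1 (est K1 L)))) : c ∈ consts (clauseSet L) := by
  obtain ⟨_, ⟨D, hD, σ, rfl, hext⟩, hc⟩ := mem_subterms_clauseSet.1 hc
  have hU : ∀ (f : E.Sym) (args : ∀ i, Term (F.sum E) X ((F.sum E).dom (Sum.inr f) i)),
      (⟨_, .app (Sum.inr f) args⟩ : Σ s, Term (F.sum E) X s) ∈ (Clause.toQF D).subterms →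
      1 ≤ E.arity f →
      (⟨_, (Term.app (F := F.sum E) (Sum.inr f) args).subst σ⟩ : Σ s, Term (F.sum E) C s) ∈
        subterms (clauseSet L) := by
    intro f args ha hf
    have hm : (⟨_, .app (Sum.inr f) args⟩ : Σ s, Term (F.sum E) X s) ∈
      extTerms {Clause.toQF D} := ⟨by rwa [subterms_singleton], trivial⟩
    rcases mem_est (fun D hD => hA.flat D (Or.inr hD)) (hext (subst_mem_extTerms hm)) with
      h | ⟨f', -, hf', b, h⟩
    · exact h.1
    · have h' := Term.extApp_inj (f := f) (g := f') h
      cases (Sigma.mk.inj_iff.1 h').1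
      omega
  rcases instance_subterms (hA.flat D (Or.inr hD)) (hA.vars_below D (Or.inr hD))
    (fun p hp => subterms_subset hp) hU hc with h | ⟨f, args, -, h⟩
  · exact h
  · exact (Term.var_ne_app h).elim

/-- Since `ψ` is an interpolant with uninterpreted symbols, `θ` itself need not follow from `Γ`. It
does follow under the finitely many instances of `K1` that concern the terms of `¬θ`, and these hold
in every model of `K1`. -/
theorem IsUniformInterpolant.isGenUniformInterpolant (hloc : IsLocal T₀ (Ks ∪ K1))
    (hA : SortConditions Ks K1 Ss' S1) {H : Set (Clause (F.sum E) P C)} (hH : H.Finite)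
    (hKs : instances Ks (sharedTerms F C Ss') ⊆ H)
    (hE : theta (Ks ∪ K1) (extSyms (clauseSet H) \ Ss') ⊆ extSyms (clauseSet H))
    {Cs : Set (Σ s, C s)} (hCs : Cs ⊆ ManySorted.consts (clauseSet H)) {Γ : QF (F.sum E) P C}
    (hΓ : IsEliminationResult T₀ K1 H (est K1 H) Ss' Cs Γ) {ψ : QF (F.sum E) P C}
    (hψs : extSyms {ψ} ⊆ Ss') (hψ : IsUniformInterpolant (uifModels T₀ E) Γ Cs ψ) :
    IsGenUniformInterpolant (extModels T₀ K1) (clauseSet H) Ss' Cs ψ := by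
  refine ⟨hψs, hψ.consts, ?_, ?_⟩
  · intro M hM v hv
    refine hψ.entails M hM.1 v ?_
    rintro _ rfl
    obtain ⟨Γ₁, hΓ₁, rfl⟩ := hΓ
    refine (QF.realize_lift M v _ Γ₁).2 ((hΓ₁ M.reduct hM.1 _).2
      ⟨M.pureVal v, fun s c => rfl, ?_⟩)
    rintro D (⟨D, hD, rfl⟩ | hD)
    · rw [← Clause.realize_toQF, Clause.toQF_purify]
      refine (Agrees.realize_iff _ (agrees_pureVal M v _)).1 ((Clause.realize_toQF M v D).2 ?_)
      rcases hD with hD | hD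
      · exact realize_of_mem_instances hM v hD
      · exact (realize_clauseSet M v H).1 hv D hD
    · exact (realize_conClauses _ _ _).2 (isCongruent_pureVal M v _) D hD
  · intro θ hsyms hconsts hent M hM v hv
    obtain ⟨L, hL, hLsub, hLθ⟩ := (exists_cnf θ).2
    have hRfin : (instances K1 (est K1 L)).Finite :=
      finite_instances hA.finite_K1 (fun D hD => hA.vars_below D (Or.inr hD))
        (finite_est hA.finite_K1 hL)
    obtain ⟨ρ, hρsub, hρ⟩ := exists_conj (hRfin.image Clause.toQF)
    -- This is `K1[est(K1, L)] → θ`, written with the available connectives.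
    let θ' : QF (F.sum E) P C := .neg (.conj ρ (.neg θ))
    have hθ' : ∀ (N : Struct (F.sum E) P) (v : N.Val C), θ'.Realize N v ↔
        ((∀ D ∈ instances K1 (est K1 L), Clause.Realize N v D) → θ.Realize N v) := by
      intro N v
      have : ρ.Realize N v ↔ ∀ D ∈ instances K1 (est K1 L), Clause.Realize N v D :=
        (hρ N v).trans (realize_clauseSet N v _)
      simp only [θ', QF.Realize, not_and, not_not, this]
    have key := hψ.strongest (fun _ => PEmpty.{u + 1}) (θ'.subst fun _ c => .var (Sum.inl c))
      ?_ ?_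
    · have h1 := key M hM.1 (fun s c => c.elim (v s) PEmpty.elim) (by
        rintro _ rfl
        exact (QF.realize_subst _ _ _ _).2 (hv ψ rfl))
      exact (hθ' M v).1 ((QF.realize_subst _ _ _ _).1 h1) fun D hD =>
        realize_of_mem_instances hM v hD
    · intro s c hc hcΓ
      have hcH := keptConsts_subset hCs (hΓ.consts_subset hA hcΓ)
      refine hconsts ⟨?_, hcH⟩
      rw [ManySorted.consts, subterms_singleton] at hc ⊢
      rcases QF.fromSubst _ _ hc with ⟨f, args, -, h⟩ | ⟨s', c', hc', h⟩
      · exact (Term.var_ne_app h).elim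
      · cases (show (⟨s, .var (.inl c)⟩ : Σ s, Term (F.sum E) (fun s => C s ⊕ PEmpty.{u + 1}) s) =
          ⟨s', .var (.inl c')⟩ from h)
        rcases hc' with hc' | hc'
        · rw [hρsub] at hc'
          exact hLsub (varsIn_instances_est hA hc')
        · exact hc'
    · intro N hN u hu
      refine (QF.realize_subst _ _ _ _).2 ((hθ' N _).2 fun hR => ?_)
      exact eq_true_of_eliminationResult hloc hA hH hKs hE hΓ hsyms hconsts hent hL hLsub hLθ hN
        ((QF.realize_subst _ _ _ _).1 (hu _ rfl)) hR

end Elimination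

end ManySorted

theorem mainTheorem5 {S : Type u}
    -- the base theory
    (F : FunSig S) (P : RelSig S) (T₀ : Set (Sentence F P))
    (hconv : IsConvex T₀) (hstab : IsStablyInfinite T₀)
    (heq : IsEqInterpolating T₀) (hqe : HasQE T₀)
    -- the extension by the symbols `E` and the clauses `Ks ∪ K1`
    (E : FunSig S) (X : S → Type u) (Ks K1 : Set (Clause (F.sum E) P X))
    (hloc : IsLocal T₀ (Ks ∪ K1))
    -- the additional constants and the ground clauses
    (C : S → Type u) (G : Set (Clause (F.sum E) P C)) (hG : G.Finite)
    (hGflat : ∀ D ∈ G, Clause.IsFlatGround D) (hGlin : ∀ D ∈ G, Clause.IsLinear D)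
    -- the shared symbols and constants
    (Ss : Set E.Sym) (hSs : Ss ⊆ extSyms (clauseSet G))
    (Cs : Set (Σ s, C s)) (hCs : Cs ⊆ consts (clauseSet G))
    (Ss' : Set E.Sym) (hSs' : Ss' = theta (Ks ∪ K1) Ss)
    (S1 : Set S) (hA : SortConditions Ks K1 Ss' S1)
    -- the additional constants of a sort in `S1` are constants of `G`
    (hC : ∀ s ∈ S1, ∀ c : C s, (⟨s, c⟩ : Σ s, C s) ∈ consts (clauseSet G))
    -- the symbols connected by `K` to symbols of `G` to be eliminated occur in `G`
    (hE : theta (Ks ∪ K1) (extSyms (clauseSet G) \ Ss') ⊆ extSyms (clauseSet G)) :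
    -- the set `T` of terms and `Ks[T]` are finite
    (sharedTerms F C Ss').Finite ∧
    (instances Ks (sharedTerms F C Ss')).Finite ∧
    -- reduction to the theory in which the symbols of `Ss'` are uninterpreted
    (∀ ψ : QF (F.sum E) P C,
      IsGenUniformInterpolant (extModels T₀ K1)
        (clauseSet (G ∪ instances Ks (sharedTerms F C Ss'))) Ss' Cs ψ →
      IsGenUniformInterpolant (extModels T₀ (Ks ∪ K1)) (clauseSet G) Ss' Cs ψ) ∧
    -- (i) the algorithm has a result
    (∃ Γ : QF (F.sum E) P C,
      IsEliminationResult T₀ K1 (G ∪ instances Ks (sharedTerms F C Ss'))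
        (est K1 (G ∪ instances Ks (sharedTerms F C Ss'))) Ss' Cs Γ) ∧
    ∀ Γ : QF (F.sum E) P C,
      IsEliminationResult T₀ K1 (G ∪ instances Ks (sharedTerms F C Ss'))
        (est K1 (G ∪ instances Ks (sharedTerms F C Ss'))) Ss' Cs Γ →
      -- it contains only the symbols and constants that are kept
      extSyms {Γ} ⊆ Ss' ∧
      consts {Γ} ⊆ keptConsts
        (extTerms (clauseSet (G ∪ instances Ks (sharedTerms F C Ss')))) Ss' Cs ∧
      -- (ii) it has a uniform interpolant in the extension with uninterpreted symbols
      (∃ ψ : QF (F.sum E) P C, extSyms {ψ} ⊆ Ss' ∧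
        IsUniformInterpolant (uifModels T₀ E) Γ Cs ψ) ∧
      -- and each such uniform interpolant is a general uniform interpolant
      ∀ ψ : QF (F.sum E) P C, extSyms {ψ} ⊆ Ss' →
        IsUniformInterpolant (uifModels T₀ E) Γ Cs ψ →
        IsGenUniformInterpolant (extModels T₀ K1)
          (clauseSet (G ∪ instances Ks (sharedTerms F C Ss'))) Ss' Cs ψ ∧
        IsGenUniformInterpolant (extModels T₀ (Ks ∪ K1)) (clauseSet G) Ss' Cs ψ := by
  have hCfin : {c : Σ s, C s | c.1 ∈ S1}.Finite :=
    (finite_varsIn (finite_subterms (hG.image Clause.toQF))).subset fun c hc => hC c.1 hc c.2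
  have hT : (sharedTerms F C Ss').Finite := hA.finite_sharedTerms hCfin
  have hKT : (instances Ks (sharedTerms F C Ss')).Finite :=
    finite_instances hA.finite_Ks (fun D hD => hA.vars_below D (Or.inl hD)) hT
  have hred : ∀ ψ : QF (F.sum E) P C,
      IsGenUniformInterpolant (extModels T₀ K1)
        (clauseSet (G ∪ instances Ks (sharedTerms F C Ss'))) Ss' Cs ψ →
      IsGenUniformInterpolant (extModels T₀ (Ks ∪ K1)) (clauseSet G) Ss' Cs ψ :=
    fun ψ hψ => hψ.of_instances hloc hA hG hC hKT
  have hH := hG.union hKT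
  have hGH : ∀ p, p ∈ subterms (clauseSet G) →
      p ∈ subterms (clauseSet (G ∪ instances Ks (sharedTerms F C Ss'))) := by
    intro p hp
    rw [clauseSet_union, subterms_union]
    exact Or.inl hp
  -- Symbols contributed by `Ks[T]` are all in `Ss'`, so the symbols to be eliminated are those of
  -- `G` and the closure hypothesis carries over.
  have hE' : theta (Ks ∪ K1)
      (extSyms (clauseSet (G ∪ instances Ks (sharedTerms F C Ss'))) \ Ss') ⊆
      extSyms (clauseSet (G ∪ instances Ks (sharedTerms F C Ss'))) := by
    rintro f ⟨g, ⟨⟨args, hg⟩, hg'⟩, hfg⟩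
    rw [clauseSet_union, subterms_union] at hg
    rcases hg with hg | hg
    · obtain ⟨a, ha⟩ := hE ⟨g, ⟨⟨args, hg⟩, hg'⟩, hfg⟩
      exact ⟨a, hGH _ ha⟩
    · exact (hg' (extSyms_instances_sharedTerms ⟨args, hg⟩)).elim
  refine ⟨hT, hKT, hred, exists_isEliminationResult hqe hA hH Cs, fun Γ hΓ => ?_⟩
  refine ⟨hΓ.extSyms_subset hA, hΓ.consts_subset hA,
    exists_uniformInterpolant heq hqe hA hT Γ (hΓ.extSyms_subset hA) Cs, fun ψ hψs hψ => ?_⟩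
  have hgen := hψ.isGenUniformInterpolant hloc hA hH Set.subset_union_right hE'
    (hCs.trans fun c hc => hGH _ hc) hΓ hψs
  exact ⟨hgen, hred ψ hgen⟩
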